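/- Let $p\in(0,1/3)$ be a constant, $p\neq 1/6$. Consider the complete graph whose nodes are $n$ ordinary agents together with $3k$ stubborn agents, of which $k$ support opinion Alpha, $k$ support opinion Beta and $k$ are undecided, where $k=\frac{p}{1-3p}\,n$ (rounded to one of the two neighbouring integers, the same for the three groups, if this is not an integer). Stubborn agents never change state. In every round each ordinary agent $u$ independently picks a node $v$ uniformly at random among all $n+3k$ nodes (possibly itself), and all ordinary agents simultaneously update their states by the Undecided-State rule: if $u$ is undecided it adopts the state of $v$; if $u$ and $v$ hold the two different opinions Alpha and Beta, $u$ becomes undecided; otherwise $u$ keeps its state. Let $X_t$ be the configuration after $t$ rounds and let $s(X_t)$ be its bias, i.e. the number of agents supporting Alpha minus the number of agents supporting Beta. (i) If $p<1/6$, there are constants $C,c,\lambda,c_1,c_2,\gamma>0$ and $n_0$, depending only on $p$, such that for every $n\ge n_0$ and every initial configuration, with probability at least $1-n^{-\gamma}$ the following holds: there are a round $T\le C\log n$ and an opinion $j\in\{\text{Alpha},\text{Beta}\}$ such that in all rounds $t$ with $T\le t\le T+c\,n^{\lambda}$ the bias towards $j$ (which is $s(X_t)$ if $j$ is Alpha and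 $-s(X_t)$ if $j$ is Beta) lies between $c_1n$ and $c_2n$. (ii) If $p>1/6$, there are constants $C,c,\lambda',M,\gamma>0$ and $n_0$, depending only on $p$, such that for every $n\ge n_0$ and every initial configuration, with probability at least $1-n^{-\gamma}$ there is a round $T\le C\log n$ such that $|s(X_t)|\le M\sqrt{n\log n}$ in all rounds $t$ with $T\le t\le T+c\,n^{\lambda'}$. -/

import Mathlib

/-- The three states of an agent: the two valid opinions and the undecided state. -/
inductive Opinion
  | alpha
  | beta
  | undecided
  deriving DecidableEq

instance : Fintype Opinion where
  elems := {Opinion.alpha, Opinion.beta, Opinion.undecided}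
  complete o := by cases o <;> decide

instance : MeasurableSpace Opinion := ⊤

instance : DiscreteMeasurableSpace Opinion := ⟨fun _ => trivial⟩

namespace Opinion

/-- The update rule of the Undecided-State dynamics: `update u v` is the new state of an agent
in state `u` that has pulled the state `v`. -/
def update : Opinion → Opinion → Opinion
  | undecided, v => v
  | alpha, beta => undecided
  | beta, alpha => undecided
  | alpha, _ => alpha
  | beta, _ => beta

end Opinion

/-- The nodes of the complete graph: `n` ordinary agents and, for each of the three states `o`,
`k` stubborn agents `(o, i)` that always hold the state `o` (so `3 * k` stubborn agents in all). -/
abbrev Node (n k : ℕ) : Type := Fin n ⊕ (Opinion × Fin k)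

instance (n k : ℕ) : DiscreteMeasurableSpace (Node n k) :=
  ⟨fun _ => measurableSet_sum_iff.2
    ⟨MeasurableSet.of_discrete, MeasurableSet.of_discrete⟩⟩

/-- A configuration: the states of the `n` ordinary agents (the stubborn ones never change). -/
abbrev Config (n : ℕ) : Type := Fin n → Opinion

/-- The state held by a node of the whole graph when the ordinary agents are in configuration
`x`. -/
def nodeState {n k : ℕ} (x : Config n) : Node n k → Opinion
  | Sum.inl u => x u
  | Sum.inr s => s.1

/-- The bias `a - b`: number of Alpha agents minus number of Beta agents. It is the same number
whether or not the stubborn agents are counted, as `k` of them support each opinion. -/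
def bias {n : ℕ} (x : Config n) : ℤ :=
  ((Finset.univ.filter fun u => x u = Opinion.alpha).card : ℤ) -
    ((Finset.univ.filter fun u => x u = Opinion.beta).card : ℤ)

/-- All random choices: `ω (t, u)` is the node pulled by the ordinary agent `u` at round `t`. -/
abbrev Choices (n k : ℕ) : Type := ℕ × Fin n → Node n k

/-- The choices are independent over rounds and agents, each one uniform over all the
`n + 3 * k` nodes (the agent itself included). -/
noncomputable def choiceMeasure (n k : ℕ) [NeZero n] : MeasureTheory.Measure (Choices n k) :=
  MeasureTheory.Measure.infinitePi fun _ : ℕ × Fin n =>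
    (PMF.uniformOfFintype (Node n k)).toMeasure

/-- The process with stubborn agents, started from `x`: in every round all ordinary agents
simultaneously apply the update rule to the state of the node that they have pulled. -/
def stubbornProcess {n k : ℕ} (x : Config n) (ω : Choices n k) : ℕ → Config n
  | 0 => x
  | t + 1 => fun u =>
      Opinion.update (stubbornProcess x ω t u) (nodeState (stubbornProcess x ω t) (ω (t, u)))

/-- Along the trajectory `X`, the bias satisfies `P` in all the rounds of a phase that starts at
some round `T ≤ start` and goes on until round `T + length`. -/
def EntersPhase {n : ℕ} (X : ℕ → Config n) (start length : ℝ) (P : ℤ → Prop) : Prop :=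
  ∃ T : ℕ, (T : ℝ) ≤ start ∧ ∀ t : ℕ, T ≤ t → (t : ℝ) ≤ T + length → P (bias (X t))

/-! Let N = n + 3k, s = bias / N, d = (undecided - n/3) / N and g = 1/3 - 2k/N. The expected round
is given exactly by s' = s(1 + g + d) and d' = (3/2)d² - s²/2 (`sum_integral_sign`,
`sum_integral_undecidedIndicator`). Since d is driven towards 0 when s is small, the sign of g
decides whether a small bias grows, and g is close to 1/3 - 2p, which changes sign at p = 1/6. A
round is a sum of n independent bounded terms, so Hoeffding's inequality keeps it within δ of its
mean except with probability 4 exp(-δ²n/2) (`measure_not_followsMean_le`). Outside a rare event the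
trajectory is therefore a deterministic recursion with errors at most δ, over logarithmically many
rounds plus n more.

For p > 1/6, δ is of order √(log n / n). The positive part of d halves in each round up to O(δ);
then |s| contracts by a factor 1 - r up to δ, and ends of order δ (`bias_small_of_followsMean`).

For p < 1/6, δ is a constant, and a relative bias of at least ρ can no longer be lost
(`InPhase.step`, `bias_persists`). Leaving the neighbourhood of s = 0 needs the noise, as the mean
dynamics does not move s = 0. The potential 1 / (n + η bias²) handles this: while |s| < ρ and d ≥
-ρ/2 its mean shrinks by a constant factor in each round, through the variance of the bias when the
bias is at most of order √n and through the multiplicative drift when it is larger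
(`integral_one_div_bias_le`). As the normalised potential lies between 1 and 2n, the bias stays
small for a large multiple of log n rounds only with small probability
(`measure_forall_small_bias_le`). -/

open MeasureTheory ProbabilityTheory

/-! ### Splitting off the first round of the choices -/

section Product

variable {α ι : Type*} [MeasurableSpace α]

/-- Prepends a first round `p.1` to the rounds `p.2`. -/
def consRound (p : (ι → α) × (ℕ × ι → α)) : ℕ × ι → α
  | (0, u) => p.1 u
  | (t + 1, u) => p.2 (t, u)

theorem measurable_consRound : Measurable (consRound : (ι → α) × (ℕ × ι → α) → ℕ × ι → α) := by
  refine measurable_pi_lambda _ fun i => ?_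
  obtain ⟨t, u⟩ := i
  cases t with
  | zero => exact (measurable_pi_apply u).comp measurable_fst
  | succ t => exact (measurable_pi_apply (t, u)).comp measurable_snd

/-- This is the Markov property: a fresh round put before an independent copy of all rounds has the
same law. Both measures are compared on finite boxes, which split into the coordinates of round 0
and the shifted ones. -/
theorem map_consRound [Fintype ι] (μ : Measure α) [IsProbabilityMeasure μ] :
    ((Measure.pi fun _ : ι => μ).prod (Measure.infinitePi fun _ : ℕ × ι => μ)).map consRound =
      Measure.infinitePi fun _ : ℕ × ι => μ := by
  classical
  refine Measure.eq_infinitePi _ fun s B hB => ?_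
  have hinj : Function.Injective fun i : ℕ × ι => (i.1 + 1, i.2) := by
    rintro ⟨a, b⟩ ⟨c, d⟩ h
    simpa using h
  set s' : Finset (ℕ × ι) := s.preimage (fun i => (i.1 + 1, i.2)) hinj.injOn with hs'
  have hpre : consRound ⁻¹' (Set.pi s B) =
      (Set.univ.pi fun u => if (0, u) ∈ s then B (0, u) else Set.univ) ×ˢ
        Set.pi s' fun i => B (i.1 + 1, i.2) := by
    ext p
    simp only [Set.mem_preimage, Set.mem_pi, Set.mem_prod, Set.mem_univ, true_imp_iff]
    constructor
    · intro h
      refine ⟨fun u => ?_, fun i hi => ?_⟩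
      · split_ifs with hu
        · exact h (0, u) hu
        · trivial
      · exact h (i.1 + 1, i.2) (by simpa [hs'] using hi)
    · rintro ⟨h0, h1⟩ ⟨t, u⟩ hi
      cases t with
      | zero =>
        have := h0 u
        rw [if_pos (by exact_mod_cast hi)] at this
        exact this
      | succ t => exact h1 (t, u) (by simpa [hs'] using hi)
  have hBs : MeasurableSet (Set.pi (s : Set (ℕ × ι)) B) :=
    MeasurableSet.pi s.countable_toSet fun i _ => hB i
  rw [Measure.map_apply measurable_consRound hBs, hpre, Measure.prod_prod, Measure.pi_pi,
    Measure.infinitePi_pi _ (fun i _ => hB _),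
    ← Finset.prod_filter_mul_prod_filter_not s (fun i => i.1 = 0)]
  congr 1
  · have : ∀ u : ι, μ (if (0, u) ∈ s then B (0, u) else Set.univ) =
        if (0, u) ∈ s then μ (B (0, u)) else 1 := by
      intro u
      split_ifs <;> simp
    simp_rw [this]
    rw [← Finset.prod_filter]
    refine Finset.prod_bij (fun u _ => (0, u)) (by simp) (by simp) ?_ (by simp)
    rintro ⟨t, u⟩ h
    simp only [Finset.mem_filter] at h
    obtain ⟨h, rfl⟩ := h
    exact ⟨u, by simpa using h, rfl⟩
  · refine Finset.prod_bij (fun i _ => (i.1 + 1, i.2)) (by simp [hs']) ?_ ?_ (by simp)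
    · intro a _ b _ h
      exact hinj h
    · rintro ⟨t, u⟩ h
      simp only [Finset.mem_filter] at h
      obtain ⟨t, rfl⟩ := Nat.exists_eq_succ_of_ne_zero h.2
      exact ⟨(t, u), by simpa [hs'] using h.1, rfl⟩

end Product

/-! ### Estimates along a trajectory by conditioning on its first round -/

/-- The configuration after one round in which agent `u` pulls the node `v u`. -/
def stepConfig {n k : ℕ} (x : Config n) (v : Fin n → Node n k) : Config n :=
  fun u => Opinion.update (x u) (nodeState x (v u))

theorem stubbornProcess_succ {n k : ℕ} (x : Config n) (ω : Choices n k) (t : ℕ) :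
    stubbornProcess x ω (t + 1) = stepConfig (stubbornProcess x ω t) fun u => ω (t, u) := rfl

theorem stubbornProcess_consRound {n k : ℕ} (x : Config n) (v : Fin n → Node n k)
    (ω : Choices n k) (t : ℕ) :
    stubbornProcess x (consRound (v, ω)) (t + 1) = stubbornProcess (stepConfig x v) ω t := by
  induction t with
  | zero => rfl
  | succ t ih => rw [stubbornProcess_succ, ih]; rfl

theorem measurable_stubbornProcess {n k : ℕ} (x : Config n) (t : ℕ) :
    Measurable fun ω : Choices n k => stubbornProcess x ω t := by
  induction t with
  | zero => exact measurable_const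
  | succ t ih =>
    have h : Measurable fun p : Config n × (Fin n → Node n k) => stepConfig p.1 p.2 :=
      Measurable.of_discrete
    exact h.comp (ih.prodMk (measurable_pi_lambda _ fun u => measurable_pi_apply (t, u)))

/-- The law of the choices of a single round. -/
noncomputable def roundMeasure (n k : ℕ) [NeZero n] : Measure (Fin n → Node n k) :=
  Measure.pi fun _ => (PMF.uniformOfFintype (Node n k)).toMeasure

instance (n k : ℕ) [NeZero n] : IsProbabilityMeasure (roundMeasure n k) := by
  unfold roundMeasure; infer_instance

instance (n k : ℕ) [NeZero n] : IsProbabilityMeasure (choiceMeasure n k) := by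
  unfold choiceMeasure; infer_instance

theorem choiceMeasure_eq_lintegral {n k : ℕ} [NeZero n] {E : Set (Choices n k)}
    (hE : MeasurableSet E) :
    choiceMeasure n k E =
      ∫⁻ v, choiceMeasure n k {ω | consRound (v, ω) ∈ E} ∂(roundMeasure n k) := by
  conv_lhs => rw [choiceMeasure, ← map_consRound, Measure.map_apply measurable_consRound hE,
    Measure.prod_apply (measurable_consRound hE)]
  rfl

/-- A union bound over rounds. What is bad may depend on the configuration reached, which is itself
random, so the bound must be uniform in the configuration and is iterated by conditioning on the
first round. -/
theorem measure_exists_round_le {n k : ℕ} [NeZero n]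
    (bad : Config n → (Fin n → Node n k) → Prop) (β : ENNReal)
    (h : ∀ x, roundMeasure n k {v | bad x v} ≤ β) (T : ℕ) (x : Config n) :
    choiceMeasure n k {ω | ∃ t < T, bad (stubbornProcess x ω t) fun u => ω (t, u)} ≤ T * β := by
  have hmeas : ∀ (x : Config n) (T : ℕ), MeasurableSet
      {ω : Choices n k | ∃ t < T, bad (stubbornProcess x ω t) fun u => ω (t, u)} := by
    intro x T
    have : {ω : Choices n k | ∃ t < T, bad (stubbornProcess x ω t) fun u => ω (t, u)} =
        ⋃ t ∈ Set.Iio T, (fun ω => (stubbornProcess x ω t, fun u => ω (t, u))) ⁻¹'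
          {p | bad p.1 p.2} := by
      ext ω; simp
    rw [this]
    refine MeasurableSet.biUnion (Set.to_countable _) fun t _ => ?_
    exact ((measurable_stubbornProcess x t).prodMk
      (measurable_pi_lambda _ fun u => measurable_pi_apply (t, u))) (MeasurableSet.of_discrete)
  induction T generalizing x with
  | zero => simp
  | succ T ih =>
    rw [choiceMeasure_eq_lintegral (hmeas x (T + 1))]
    calc ∫⁻ v, choiceMeasure n k {ω | consRound (v, ω) ∈ {ω | ∃ t < T + 1,
            bad (stubbornProcess x ω t) fun u => ω (t, u)}} ∂(roundMeasure n k)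
        ≤ ∫⁻ v, ({v | bad x v}.indicator 1 v + T * β) ∂(roundMeasure n k) := by
          refine lintegral_mono fun v => ?_
          by_cases hv : bad x v
          · rw [Set.indicator_of_mem (by exact hv)]
            exact (prob_le_one).trans (by simp)
          · refine le_trans (measure_mono ?_) ((ih (stepConfig x v)).trans le_add_self)
            rintro ω ⟨t, ht, hb⟩
            cases t with
            | zero => exact absurd hb hv
            | succ t =>
              refine ⟨t, by omega, ?_⟩
              rw [stubbornProcess_consRound] at hb
              exact hb
      _ = roundMeasure n k {v | bad x v} + T * β := by
          rw [lintegral_add_right _ measurable_const,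
            lintegral_indicator_one MeasurableSet.of_discrete]
          simp
      _ ≤ (T + 1 : ℕ) * β := by
          push_cast
          rw [add_mul, one_mul, add_comm]
          gcongr
          exact h x

theorem measurableSet_forall_mem {n k : ℕ} (G : Set (Config n)) (x : Config n) (T : ℕ) :
    MeasurableSet {ω : Choices n k | ∀ t ≤ T, stubbornProcess x ω t ∈ G} := by
  have : {ω : Choices n k | ∀ t ≤ T, stubbornProcess x ω t ∈ G} =
      ⋂ t ∈ Set.Iic T, (fun ω => stubbornProcess x ω t) ⁻¹' G := by
    ext ω; simp
  rw [this]
  exact MeasurableSet.biInter (Set.to_countable _) fun t _ =>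
    measurable_stubbornProcess x t MeasurableSet.of_discrete

/-- A supermartingale argument: φ dominates the indicator of `G` and loses a factor `r` in mean for
each round started in `G`. -/
theorem measure_forall_mem_le {n k : ℕ} [NeZero n] (G : Set (Config n)) (φ : Config n → ENNReal)
    (r : ENNReal) (h1 : ∀ x ∈ G, 1 ≤ φ x)
    (h : ∀ x ∈ G, ∫⁻ v, φ (stepConfig x v) ∂(roundMeasure n k) ≤ r * φ x) (T : ℕ)
    (x : Config n) :
    choiceMeasure n k {ω | ∀ t ≤ T, stubbornProcess x ω t ∈ G} ≤ r ^ T * φ x := by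
  have hempty : ∀ (x : Config n) (T : ℕ), x ∉ G →
      {ω : Choices n k | ∀ t ≤ T, stubbornProcess x ω t ∈ G} = ∅ := fun x T hx =>
    Set.eq_empty_of_forall_notMem fun ω hω => hx (hω 0 (Nat.zero_le T))
  induction T generalizing x with
  | zero =>
    by_cases hx : x ∈ G
    · simpa using prob_le_one.trans (h1 x hx)
    · rw [hempty x 0 hx]
      simp
  | succ T ih =>
    by_cases hx : x ∈ G
    · rw [choiceMeasure_eq_lintegral (measurableSet_forall_mem G x (T + 1))]
      calc ∫⁻ v, choiceMeasure n k {ω | consRound (v, ω) ∈ {ω | ∀ t ≤ T + 1,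
              stubbornProcess x ω t ∈ G}} ∂(roundMeasure n k)
          ≤ ∫⁻ v, r ^ T * φ (stepConfig x v) ∂(roundMeasure n k) := by
            refine lintegral_mono fun v => (measure_mono ?_).trans (ih (stepConfig x v))
            intro ω hω t ht
            have := hω (t + 1) (by omega)
            rwa [stubbornProcess_consRound] at this
        _ = r ^ T * ∫⁻ v, φ (stepConfig x v) ∂(roundMeasure n k) :=
            lintegral_const_mul _ Measurable.of_discrete
        _ ≤ r ^ T * (r * φ x) := by gcongr; exact h x hx
        _ = r ^ (T + 1) * φ x := by rw [pow_succ, mul_assoc]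
    · rw [hempty x (T + 1) hx]
      simp

/-- The initial configuration is arbitrary and may lie outside `G`, so round 0 is exempted and the
starting value of φ is replaced by its supremum. -/
theorem measure_forall_mem_succ_le {n k : ℕ} [NeZero n] (G : Set (Config n))
    (φ : Config n → ENNReal) (r K : ENNReal) (h1 : ∀ x ∈ G, 1 ≤ φ x) (hK : ∀ x, φ x ≤ K)
    (h : ∀ x ∈ G, ∫⁻ v, φ (stepConfig x v) ∂(roundMeasure n k) ≤ r * φ x) (T : ℕ)
    (x : Config n) :
    choiceMeasure n k {ω | ∀ t ≤ T, stubbornProcess x ω (t + 1) ∈ G} ≤ r ^ T * K := by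
  have hmeas : MeasurableSet {ω : Choices n k | ∀ t ≤ T, stubbornProcess x ω (t + 1) ∈ G} := by
    have : {ω : Choices n k | ∀ t ≤ T, stubbornProcess x ω (t + 1) ∈ G} =
        ⋂ t ∈ Set.Iic T, (fun ω => stubbornProcess x ω (t + 1)) ⁻¹' G := by
      ext ω; simp
    rw [this]
    exact MeasurableSet.biInter (Set.to_countable _) fun t _ =>
      measurable_stubbornProcess x (t + 1) MeasurableSet.of_discrete
  rw [choiceMeasure_eq_lintegral hmeas]
  calc ∫⁻ v, choiceMeasure n k {ω | consRound (v, ω) ∈ {ω | ∀ t ≤ T,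
          stubbornProcess x ω (t + 1) ∈ G}} ∂(roundMeasure n k)
      ≤ ∫⁻ _v, r ^ T * K ∂(roundMeasure n k) := by
        refine lintegral_mono fun v => ?_
        simp only [Set.mem_ofPred_eq, stubbornProcess_consRound]
        exact (measure_forall_mem_le G φ r h1 h T _).trans (by gcongr; exact hK _)
    _ = r ^ T * K := by simp

/-! ### Moments and tails of independent sums, and the drift of the potential -/

section IndependentSum

variable {α : Type*} [MeasurableSpace α] [Finite α] [DiscreteMeasurableSpace α] {n : ℕ}

theorem integral_sum_pi (μ : Measure α) [IsProbabilityMeasure μ] (f : Fin n → α → ℝ) :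
    ∫ v, ∑ u, f u (v u) ∂(Measure.pi fun _ : Fin n => μ) = ∑ u, ∫ a, f u a ∂μ := by
  rw [integral_finsetSum _ fun u _ => Integrable.of_finite]
  refine Finset.sum_congr rfl fun u _ => ?_
  exact integral_comp_eval (μ := fun _ : Fin n => μ) (Measurable.of_discrete).aestronglyMeasurable

theorem hasSubgaussianMGF_sum_pi (μ : Measure α) [IsProbabilityMeasure μ] (f : Fin n → α → ℝ)
    (hf : ∀ u a, f u a ∈ Set.Icc (-1 : ℝ) 1) :
    HasSubgaussianMGF (fun v => ∑ u, f u (v u) - ∑ u, ∫ a, f u a ∂μ) n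
      (Measure.pi fun _ : Fin n => μ) := by
  have hind : iIndepFun (fun (u : Fin n) (v : Fin n → α) => f u (v u) - ∫ a, f u a ∂μ)
      (Measure.pi fun _ : Fin n => μ) :=
    iIndepFun_pi (X := fun u a => f u a - ∫ a, f u a ∂μ)
      fun u => (Measurable.of_discrete).aemeasurable
  have hsub : ∀ u ∈ (Finset.univ : Finset (Fin n)),
      HasSubgaussianMGF (fun v : Fin n → α => f u (v u) - ∫ a, f u a ∂μ) 1
        (Measure.pi fun _ : Fin n => μ) := by
    intro u _
    have h := hasSubgaussianMGF_of_mem_Icc (X := fun v : Fin n → α => f u (v u))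
      (μ := Measure.pi fun _ : Fin n => μ) (Measurable.of_discrete).aemeasurable
      (Filter.Eventually.of_forall fun v => hf u (v u))
    have hc : (‖(1 : ℝ) - -1‖₊ / 2) ^ 2 = 1 := by
      ext; norm_num
    rw [hc] at h
    have he : ∫ v, f u (v u) ∂(Measure.pi fun _ : Fin n => μ) = ∫ a, f u a ∂μ :=
      integral_comp_eval (μ := fun _ : Fin n => μ)
        (Measurable.of_discrete).aestronglyMeasurable
    rwa [he] at h
  have h := HasSubgaussianMGF.sum_of_iIndepFun hind hsub
  simpa [Finset.sum_sub_distrib] using h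

theorem integral_sq_sum_pi (μ : Measure α) [IsProbabilityMeasure μ] (f : Fin n → α → ℝ) :
    ∫ v, (∑ u, f u (v u) - ∑ u, ∫ a, f u a ∂μ) ^ 2 ∂(Measure.pi fun _ : Fin n => μ) =
      ∑ u, ∫ a, (f u a - ∫ b, f u b ∂μ) ^ 2 ∂μ := by
  have h := variance_sum_pi (μ := fun _ : Fin n => μ) (X := f)
    fun u => ⟨(Measurable.of_discrete).aestronglyMeasurable, eLpNorm_lt_top_of_finite⟩
  rw [variance_eq_integral (Measurable.of_discrete).aemeasurable] at h
  simp_rw [variance_eq_integral (Measurable.of_discrete (f := f _)).aemeasurable] at h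
  rw [← h]
  have he := integral_sum_pi μ f
  simp only [Finset.sum_apply, he]

theorem measure_abs_ge_le {Ω : Type*} [MeasurableSpace Ω] {μ : Measure Ω} [IsFiniteMeasure μ]
    {X : Ω → ℝ} {c : NNReal} (h : HasSubgaussianMGF X c μ) {ε : ℝ} (hε : 0 ≤ ε) :
    μ.real {ω | ε ≤ |X ω|} ≤ 2 * Real.exp (-ε ^ 2 / (2 * c)) := by
  have h1 := h.measure_ge_le hε
  have h2 := h.neg.measure_ge_le hε
  calc μ.real {ω | ε ≤ |X ω|} ≤ μ.real ({ω | ε ≤ X ω} ∪ {ω | ε ≤ (-X) ω}) :=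
        measureReal_mono fun ω hω => by
          simpa [le_abs] using hω
    _ ≤ _ := (measureReal_union_le _ _).trans (by linarith)

theorem pow_four_le_exp_add_exp (x : ℝ) : x ^ 4 ≤ 24 * (Real.exp x + Real.exp (-x)) := by
  have h := Real.pow_div_factorial_le_exp |x| (abs_nonneg x) 4
  have h4 : |x| ^ 4 = x ^ 4 := by rw [← abs_pow, abs_of_nonneg (by positivity)]
  rw [h4, div_le_iff₀ (by positivity)] at h
  have h24 : ((Nat.factorial 4 : ℕ) : ℝ) = 24 := by norm_num [Nat.factorial]
  rw [h24] at h
  have hx := Real.exp_pos x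
  have hx' := Real.exp_pos (-x)
  rcases abs_cases x with ⟨he, _⟩ | ⟨he, _⟩ <;> rw [he] at h <;> linarith

theorem integral_pow_four_le {Ω : Type*} [MeasurableSpace Ω] {μ : Measure Ω}
    [IsProbabilityMeasure μ] {X : Ω → ℝ} {n : ℕ} (hn : 0 < n) (h : HasSubgaussianMGF X n μ) :
    ∫ ω, X ω ^ 4 ∂μ ≤ 96 * (n : ℝ) ^ 2 := by
  have hn' : (0 : ℝ) < n := by exact_mod_cast hn
  -- At this scale both moment generating functions are at most exp(1/2) < 2, and x⁴ ≤ 24(eˣ + e⁻ˣ)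
  -- turns this into 24 · 4 · n².
  set t : ℝ := 1 / Real.sqrt n with ht
  have ht2 : n * t ^ 2 = 1 := by
    rw [ht, div_pow, Real.sq_sqrt hn'.le]
    field_simp
  have hexp : Real.exp (1 / 2) ≤ 2 := by
    have h1 : Real.exp (1 / 2) ^ 2 = Real.exp 1 := by
      rw [← Real.exp_nat_mul]; norm_num
    nlinarith [Real.exp_one_lt_d9, Real.exp_pos (1 / 2)]
  have hp := h.mgf_le t
  have hm := h.mgf_le (-t)
  rw [neg_sq] at hm
  have hc : ((n : NNReal) : ℝ) * t ^ 2 / 2 = 1 / 2 := by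
    rw [NNReal.coe_natCast, ht2]
  rw [hc] at hp hm
  unfold mgf at hp hm
  have hpt : ∀ ω, X ω ^ 4 ≤
      24 * (n : ℝ) ^ 2 * (Real.exp (t * X ω) + Real.exp (-t * X ω)) := by
    intro ω
    have h1 := pow_four_le_exp_add_exp (t * X ω)
    have h2 : X ω ^ 4 = (n : ℝ) ^ 2 * (t * X ω) ^ 4 := by
      have : (n : ℝ) ^ 2 * (t * X ω) ^ 4 = (n * t ^ 2) ^ 2 * X ω ^ 4 := by ring
      rw [this, ht2]; ring
    rw [h2, neg_mul]
    calc (n : ℝ) ^ 2 * (t * X ω) ^ 4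
        ≤ (n : ℝ) ^ 2 * (24 * (Real.exp (t * X ω) + Real.exp (-(t * X ω)))) := by gcongr
      _ = _ := by ring
  calc ∫ ω, X ω ^ 4 ∂μ
      ≤ ∫ ω, 24 * (n : ℝ) ^ 2 * (Real.exp (t * X ω) + Real.exp (-t * X ω)) ∂μ :=
        integral_mono_of_nonneg (Filter.Eventually.of_forall fun ω => by positivity)
          (((h.integrable_exp_mul t).add (h.integrable_exp_mul (-t))).const_mul _)
          (Filter.Eventually.of_forall hpt)
    _ = 24 * (n : ℝ) ^ 2 *
        (∫ ω, Real.exp (t * X ω) ∂μ + ∫ ω, Real.exp (-t * X ω) ∂μ) := by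
        rw [integral_const_mul, integral_add (h.integrable_exp_mul t) (h.integrable_exp_mul (-t))]
    _ ≤ 24 * (n : ℝ) ^ 2 * (2 + 2) := by
        gcongr <;> linarith
    _ = 96 * (n : ℝ) ^ 2 := by ring

/-- The expansion to second order is exact with remainder Δ² / ((D + Δ)D²); only the factor D + Δ is
replaced by its lower bound n. -/
theorem one_div_add_le {n D Δ : ℝ} (hn : 0 < n) (hD : 0 < D) (h : n ≤ D + Δ) :
    1 / (D + Δ) ≤ 1 / D - Δ / D ^ 2 + Δ ^ 2 / (n * D ^ 2) := by
  have hS : 0 < D + Δ := hn.trans_le h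
  have he : 1 / (D + Δ) = 1 / D - Δ / D ^ 2 + Δ ^ 2 / ((D + Δ) * D ^ 2) := by
    field_simp; ring
  rw [he]
  gcongr

theorem one_div_sq_drift_arith {n m s v κ η V : ℝ} (hn : 0 < n) (hv : 0 < v) (hv1 : v ≤ 1)
    (hη : 0 < η) (hη1 : η ≤ v / 800) (hη2 : 208 * η ≤ κ)
    (hs : s ^ 2 ≤ (1 - 17 * κ) * m ^ 2) (hV : v * n ≤ V) (hV1 : V ≤ n) :
    1 / (n + η * m ^ 2) - η * V / (n + η * m ^ 2) ^ 2 +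
      η ^ 2 * (8 * m ^ 2 * V + 192 * n ^ 2) / (n * (n + η * m ^ 2) ^ 2) ≤
      (1 - η * v / 8) / (n + η * s ^ 2) := by
  have hm : 0 ≤ η * m ^ 2 := by positivity
  set D := n + η * m ^ 2 with hD
  have hDn : n ≤ D := by linarith
  have hDp : 0 < D := hn.trans_le hDn
  have hκ0 : 0 < κ := by linarith
  have hsD : n + η * s ^ 2 ≤ D := by nlinarith
  have hsp : 0 < n + η * s ^ 2 := by positivity
  have hηv : η * v ≤ η := by nlinarith
  -- For a small mean the variance term -ηV/D² provides the decrease. For a large mean the expansion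
  -- may lose a factor 1 + 104η, which the gap between s² and m² repays.
  rcases le_or_gt (η * m ^ 2) (n / 16) with hc | hc
  · have hA : 1 / D - η * V / D ^ 2 + η ^ 2 * (8 * m ^ 2 * V + 192 * n ^ 2) / (n * D ^ 2) ≤
        (1 - η * v / 8) / D := by
      have : (1 - η * v / 8) / D -
          (1 / D - η * V / D ^ 2 + η ^ 2 * (8 * m ^ 2 * V + 192 * n ^ 2) / (n * D ^ 2)) =
          η * (n * V - n * v * D / 8 - 8 * (η * m ^ 2) * V - 192 * η * n ^ 2) / (n * D ^ 2) := by
        field_simp; ring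
      rw [← sub_nonneg, this]
      have hVp : 0 < V := lt_of_lt_of_le (by positivity) hV
      have h1 : 8 * (η * m ^ 2) * V ≤ n * V / 2 := by nlinarith
      have h2 : n * v * D / 8 ≤ n * v * n * (17 / 128) := by
        have : D ≤ n * (17 / 16) := by linarith
        have : n * v * D ≤ n * v * (n * (17 / 16)) := by gcongr
        linarith
      have h3 : 192 * η * n ^ 2 ≤ 192 * (v / 800) * n ^ 2 := by gcongr
      have h4 : n * (v * n) ≤ n * V := by gcongr
      have h5 : 0 ≤ n * v * n := by positivity
      have : 0 ≤ n * V - n * v * D / 8 - 8 * (η * m ^ 2) * V - 192 * η * n ^ 2 := by nlinarith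
      positivity
    refine hA.trans ?_
    have : 0 ≤ 1 - η * v / 8 := by linarith
    gcongr
  · have hA : 1 / D - η * V / D ^ 2 + η ^ 2 * (8 * m ^ 2 * V + 192 * n ^ 2) / (n * D ^ 2) ≤
        (1 + 104 * η) / D := by
      have : (1 + 104 * η) / D -
          (1 / D - η * V / D ^ 2 + η ^ 2 * (8 * m ^ 2 * V + 192 * n ^ 2) / (n * D ^ 2)) =
          η * (104 * n * D + n * V - 8 * (η * m ^ 2) * V - 192 * η * n ^ 2) / (n * D ^ 2) := by
        field_simp; ring
      rw [← sub_nonneg, this]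
      have hVp : 0 < V := lt_of_lt_of_le (by positivity) hV
      have h1 : 8 * (η * m ^ 2) * V ≤ 8 * D * n := by
        have : η * m ^ 2 ≤ D := by linarith
        have : η * m ^ 2 * V ≤ D * n := by gcongr
        linarith
      have h3 : 192 * η * n ^ 2 ≤ 192 * 1 * (n * D) := by
        have : η ≤ 1 / 4 := by linarith
        have : n * n ≤ n * D := by gcongr
        nlinarith
      have h5 : 0 < n * V := by positivity
      have h6 : η * n ^ 2 ≤ n * D * (1 / 800) := by
        have h7 : η ≤ 1 / 800 := by linarith
        have h8 : n * n ≤ n * D := by gcongr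
        nlinarith
      have : 0 ≤ 104 * n * D + n * V - 8 * (η * m ^ 2) * V - 192 * η * n ^ 2 := by
        have : 0 < n * D := by positivity
        nlinarith
      positivity
    refine hA.trans ?_
    rw [div_le_div_iff₀ hDp hsp]
    -- Here D < 17ηm², so lowering m² by the fraction 17κ lowers D by at least κD.
    have h1 : n + η * s ^ 2 ≤ (1 - κ) * D := by
      have : η * s ^ 2 ≤ η * ((1 - 17 * κ) * m ^ 2) := by gcongr
      nlinarith
    have h2 : (1 + 104 * η) * (1 - κ) ≤ 1 - η * v / 8 := by nlinarith
    calc (1 + 104 * η) * (n + η * s ^ 2) ≤ (1 + 104 * η) * ((1 - κ) * D) := by gcongr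
      _ = (1 + 104 * η) * (1 - κ) * D := by ring
      _ ≤ (1 - η * v / 8) * D := by gcongr

/-- If `X` has mean `m`, `|m|` being larger than `|s|` by a constant factor, fluctuations of order
`√n` and a fourth moment of order `n ^ 2`, then `1 / (n + η * X ^ 2)` is in the mean smaller than
`1 / (n + η * s ^ 2)` by a constant factor. -/
theorem integral_one_div_le {Ω : Type*} [MeasurableSpace Ω] {μ : Measure Ω}
    [IsProbabilityMeasure μ] [Finite Ω] [DiscreteMeasurableSpace Ω] {X : Ω → ℝ}
    {n m s v κ η : ℝ} (hn : 0 < n) (hv : 0 < v) (hv1 : v ≤ 1)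
    (hη : 0 < η) (hη1 : η ≤ v / 800) (hη2 : 208 * η ≤ κ)
    (hs : s ^ 2 ≤ (1 - 17 * κ) * m ^ 2) (hm : ∫ ω, X ω ∂μ = m)
    (hV : v * n ≤ ∫ ω, (X ω - m) ^ 2 ∂μ) (hV1 : ∫ ω, (X ω - m) ^ 2 ∂μ ≤ n)
    (h4 : ∫ ω, (X ω - m) ^ 4 ∂μ ≤ 96 * n ^ 2) :
    ∫ ω, 1 / (n + η * X ω ^ 2) ∂μ ≤ (1 - η * v / 8) / (n + η * s ^ 2) := by
  set D := n + η * m ^ 2 with hD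
  have hDp : 0 < D := by positivity
  have hpt : ∀ ω, 1 / (n + η * X ω ^ 2) ≤
      1 / D - (2 * η * m / D ^ 2) * (X ω - m) - η / D ^ 2 * (X ω - m) ^ 2 +
        (8 * η ^ 2 * m ^ 2 / (n * D ^ 2) * (X ω - m) ^ 2 +
          2 * η ^ 2 / (n * D ^ 2) * (X ω - m) ^ 4) := by
    intro ω
    have h := one_div_add_le (n := n) (D := D) (Δ := η * (2 * m * (X ω - m) + (X ω - m) ^ 2)) hn hDp
      (by
        have : D + η * (2 * m * (X ω - m) + (X ω - m) ^ 2) = n + η * X ω ^ 2 := by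
          rw [hD]; ring
        rw [this]
        have : 0 ≤ η * X ω ^ 2 := by positivity
        linarith)
    have he : D + η * (2 * m * (X ω - m) + (X ω - m) ^ 2) = n + η * X ω ^ 2 := by
      rw [hD]; ring
    rw [he] at h
    refine h.trans ?_
    -- The inequality (a + b)² ≤ 2a² + 2b² avoids the third central moment, so that the variance and
    -- the fourth moment suffice.
    have h2 : (η * (2 * m * (X ω - m) + (X ω - m) ^ 2)) ^ 2 ≤
        8 * η ^ 2 * m ^ 2 * (X ω - m) ^ 2 + 2 * η ^ 2 * (X ω - m) ^ 4 := by
      have : 0 ≤ (η * (2 * m * (X ω - m) - (X ω - m) ^ 2)) ^ 2 := sq_nonneg _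
      nlinarith
    have h3 : (η * (2 * m * (X ω - m) + (X ω - m) ^ 2)) ^ 2 / (n * D ^ 2) ≤
        (8 * η ^ 2 * m ^ 2 * (X ω - m) ^ 2 + 2 * η ^ 2 * (X ω - m) ^ 4) / (n * D ^ 2) := by
      gcongr
    calc _ ≤ 1 / D - η * (2 * m * (X ω - m) + (X ω - m) ^ 2) / D ^ 2 +
          (8 * η ^ 2 * m ^ 2 * (X ω - m) ^ 2 + 2 * η ^ 2 * (X ω - m) ^ 4) / (n * D ^ 2) := by
          linarith
      _ = _ := by ring
  have h1 : ∫ ω, (X ω - m) ∂μ = 0 := by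
    rw [integral_sub Integrable.of_finite Integrable.of_finite, hm]
    simp
  set V := ∫ ω, (X ω - m) ^ 2 ∂μ with hVdef
  calc ∫ ω, 1 / (n + η * X ω ^ 2) ∂μ
      ≤ ∫ ω, (1 / D - (2 * η * m / D ^ 2) * (X ω - m) - η / D ^ 2 * (X ω - m) ^ 2 +
        (8 * η ^ 2 * m ^ 2 / (n * D ^ 2) * (X ω - m) ^ 2 +
          2 * η ^ 2 / (n * D ^ 2) * (X ω - m) ^ 4)) ∂μ :=
        integral_mono Integrable.of_finite Integrable.of_finite hpt
    _ = 1 / D - η / D ^ 2 * V + (8 * η ^ 2 * m ^ 2 / (n * D ^ 2) * V +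
          2 * η ^ 2 / (n * D ^ 2) * ∫ ω, (X ω - m) ^ 4 ∂μ) := by
        rw [integral_add Integrable.of_finite Integrable.of_finite,
          integral_add Integrable.of_finite Integrable.of_finite,
          integral_sub Integrable.of_finite Integrable.of_finite,
          integral_sub Integrable.of_finite Integrable.of_finite,
          integral_const_mul, integral_const_mul, integral_const_mul, integral_const_mul, h1]
        simp [hVdef]
    _ ≤ 1 / D - η / D ^ 2 * V + (8 * η ^ 2 * m ^ 2 / (n * D ^ 2) * V +
          2 * η ^ 2 / (n * D ^ 2) * (96 * n ^ 2)) := by gcongr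
    _ = 1 / D - η * V / D ^ 2 + η ^ 2 * (8 * m ^ 2 * V + 192 * n ^ 2) / (n * D ^ 2) := by ring
    _ ≤ _ := one_div_sq_drift_arith hn hv hv1 hη hη1 hη2 hs hV hV1

end IndependentSum

/-! ### The expected round in terms of relative bias and excess -/

namespace Opinion

theorem sum_univ {M : Type*} [AddCommMonoid M] (f : Opinion → M) :
    ∑ o, f o = f alpha + f beta + f undecided := by
  change ∑ o ∈ {alpha, beta, undecided}, f o = _
  rw [Finset.sum_insert (by decide), Finset.sum_insert (by decide), Finset.sum_singleton,
    add_assoc]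

/-- The contribution of an agent to the bias. -/
def sign : Opinion → ℝ
  | alpha => 1
  | beta => -1
  | undecided => 0

/-- The contribution of an agent to the number of undecided agents. -/
def undecidedIndicator : Opinion → ℝ
  | undecided => 1
  | _ => 0

end Opinion

/-- The number of ordinary agents in state `o`. -/
noncomputable def count {n : ℕ} (x : Config n) (o : Opinion) : ℝ :=
  (Finset.univ.filter fun u => x u = o).card

theorem sum_comp_config {n : ℕ} (x : Config n) (f : Opinion → ℝ) :
    ∑ u, f (x u) = count x .alpha * f .alpha + count x .beta * f .beta +
      count x .undecided * f .undecided := by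
  rw [← Finset.sum_fiberwise (s := Finset.univ) (g := x) (f := fun u => f (x u)), Opinion.sum_univ]
  congr 1
  · congr 1 <;>
    · rw [count, Finset.sum_congr rfl fun u hu => by rw [(Finset.mem_filter.1 hu).2],
        Finset.sum_const, nsmul_eq_mul]
  · rw [count, Finset.sum_congr rfl fun u hu => by rw [(Finset.mem_filter.1 hu).2],
        Finset.sum_const, nsmul_eq_mul]

theorem count_nonneg {n : ℕ} (x : Config n) (o : Opinion) : 0 ≤ count x o := Nat.cast_nonneg _

theorem sum_count {n : ℕ} (x : Config n) :
    count x .alpha + count x .beta + count x .undecided = n := by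
  have := sum_comp_config x fun _ => 1
  simpa using this.symm

theorem bias_eq_count {n : ℕ} (x : Config n) : (bias x : ℝ) = count x .alpha - count x .beta := by
  simp [bias, count]

theorem bias_eq_sum {n : ℕ} (x : Config n) : (bias x : ℝ) = ∑ u, (x u).sign := by
  rw [sum_comp_config, bias_eq_count]
  simp [Opinion.sign]
  ring

theorem count_undecided_eq_sum {n : ℕ} (x : Config n) :
    count x .undecided = ∑ u, (x u).undecidedIndicator := by
  rw [sum_comp_config]
  simp [Opinion.undecidedIndicator]

theorem integral_nodeState {n k : ℕ} [NeZero n] (x : Config n) (f : Opinion → ℝ) :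
    ∫ a, f (nodeState x a) ∂(PMF.uniformOfFintype (Node n k)).toMeasure =
      ((count x .alpha + k) * f .alpha + (count x .beta + k) * f .beta +
        (count x .undecided + k) * f .undecided) / (n + 3 * k) := by
  have hcard : Fintype.card Opinion = 3 := rfl
  rw [PMF.integral_eq_sum]
  simp only [PMF.uniformOfFintype_apply, Fintype.card_sum, Fintype.card_fin, Fintype.card_prod,
    hcard, smul_eq_mul]
  rw [← Finset.mul_sum, Fintype.sum_sum_type, Fintype.sum_prod_type]
  simp only [nodeState]
  rw [sum_comp_config, Opinion.sum_univ]
  have hreal : ((((n + 3 * k : ℕ) : ENNReal))⁻¹).toReal = ((n : ℝ) + 3 * k)⁻¹ := by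
    rw [ENNReal.toReal_inv, ENNReal.toReal_natCast]
    push_cast
    rfl
  rw [hreal]
  simp
  ring

/-- The mean number of agents in the next round, weighted by `f`. -/
theorem sum_integral_update {n k : ℕ} [NeZero n] (x : Config n) (f : Opinion → ℝ) :
    ∑ u, ∫ a, f (Opinion.update (x u) (nodeState x a))
        ∂(PMF.uniformOfFintype (Node n k)).toMeasure =
      (count x .alpha * ((count x .alpha + k) * f .alpha + (count x .beta + k) * f .undecided +
          (count x .undecided + k) * f .alpha) +
        count x .beta * ((count x .alpha + k) * f .undecided + (count x .beta + k) * f .beta +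
          (count x .undecided + k) * f .beta) +
        count x .undecided * ((count x .alpha + k) * f .alpha + (count x .beta + k) * f .beta +
          (count x .undecided + k) * f .undecided)) / (n + 3 * k) := by
  have h : ∀ o, ∫ a, f (Opinion.update o (nodeState x a))
      ∂(PMF.uniformOfFintype (Node n k)).toMeasure = _ := fun o =>
    integral_nodeState x fun o' => f (Opinion.update o o')
  simp_rw [h]
  rw [sum_comp_config x fun o => ((count x .alpha + k) * f (Opinion.update o .alpha) +
    (count x .beta + k) * f (Opinion.update o .beta) +
    (count x .undecided + k) * f (Opinion.update o .undecided)) / (n + 3 * k)]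
  simp only [Opinion.update]
  ring

/-- The bias as a fraction of all the nodes. -/
noncomputable def relBias {n : ℕ} (k : ℕ) (x : Config n) : ℝ := bias x / (n + 3 * k)

/-- The excess of the number of undecided ordinary agents over `n / 3`, as a fraction of all
the nodes. -/
noncomputable def relExcess {n : ℕ} (k : ℕ) (x : Config n) : ℝ :=
  (count x .undecided - n / 3) / (n + 3 * k)

/-- The rate at which a small bias grows while a third of the agents is undecided. -/
noncomputable def growthRate (n k : ℕ) : ℝ := 1 / 3 - 2 * (k / (n + 3 * k))

theorem sum_integral_sign {n k : ℕ} [NeZero n] (x : Config n) :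
    (∑ u, ∫ a, (Opinion.update (x u) (nodeState x a)).sign
        ∂(PMF.uniformOfFintype (Node n k)).toMeasure) / (n + 3 * k) =
      relBias k x * (1 + growthRate n k + relExcess k x) := by
  have hn : (0 : ℝ) < n := by exact_mod_cast Nat.pos_of_ne_zero (NeZero.ne n)
  have hk : (0 : ℝ) ≤ k := Nat.cast_nonneg k
  rw [sum_integral_update, relBias, relExcess, growthRate, bias_eq_count]
  have h := sum_count x
  -- Writing n as the sum of the three counts turns the claim into an identity of rational
  -- functions.
  have hn' : (0 : ℝ) < count x .alpha + count x .beta + count x .undecided := by rw [h]; exact hn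
  simp only [Opinion.sign]
  rw [← h]
  field_simp
  ring

theorem sum_integral_undecidedIndicator {n k : ℕ} [NeZero n] (x : Config n) :
    ((∑ u, ∫ a, (Opinion.update (x u) (nodeState x a)).undecidedIndicator
        ∂(PMF.uniformOfFintype (Node n k)).toMeasure) - n / 3) / (n + 3 * k) =
      3 / 2 * relExcess k x ^ 2 - relBias k x ^ 2 / 2 := by
  have hn : (0 : ℝ) < n := by exact_mod_cast Nat.pos_of_ne_zero (NeZero.ne n)
  have hk : (0 : ℝ) ≤ k := Nat.cast_nonneg k
  rw [sum_integral_update, relBias, relExcess, bias_eq_count]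
  have h := sum_count x
  have hn' : (0 : ℝ) < count x .alpha + count x .beta + count x .undecided := by rw [h]; exact hn
  simp only [Opinion.undecidedIndicator]
  rw [← h]
  field_simp
  ring

theorem abs_relBias_le {n k : ℕ} [NeZero n] (x : Config n) :
    |relBias k x| ≤ 2 / 3 * (n / (n + 3 * k)) - relExcess k x := by
  have hn : (0 : ℝ) < n := by exact_mod_cast Nat.pos_of_ne_zero (NeZero.ne n)
  have hN : (0 : ℝ) < n + 3 * k := by positivity
  have h := sum_count x
  have ha := count_nonneg x .alpha
  have hb := count_nonneg x .beta
  have he : 2 / 3 * ((n : ℝ) / (n + 3 * k)) - relExcess k x =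
      (count x .alpha + count x .beta) / (n + 3 * k) := by
    rw [relExcess, ← h]; ring
  rw [he, relBias, bias_eq_count, abs_div, abs_of_pos hN]
  gcongr
  rw [abs_le]
  constructor <;> linarith

theorem neg_le_relExcess {n k : ℕ} [NeZero n] (x : Config n) :
    -(1 / 3 * (n / (n + 3 * k))) ≤ relExcess k x := by
  have hn : (0 : ℝ) < n := by exact_mod_cast Nat.pos_of_ne_zero (NeZero.ne n)
  have hN : (0 : ℝ) < n + 3 * k := by positivity
  have he : -(1 / 3 * ((n : ℝ) / (n + 3 * k))) = (0 - n / 3) / (n + 3 * k) := by ring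
  rw [he, relExcess]
  have := count_nonneg x .undecided
  gcongr

/-! ### Concentration and variance of one round -/

/-- One round follows the expected dynamics up to an error `δ`. -/
def FollowsMean {n k : ℕ} (δ : ℝ) (x : Config n) (v : Fin n → Node n k) : Prop :=
  |relBias k (stepConfig x v) - relBias k x * (1 + growthRate n k + relExcess k x)| ≤ δ ∧
  |relExcess k (stepConfig x v) - (3 / 2 * relExcess k x ^ 2 - relBias k x ^ 2 / 2)| ≤ δ

theorem measure_not_followsMean_le {n k : ℕ} [NeZero n] {δ : ℝ} (hδ : 0 ≤ δ) (x : Config n) :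
    (roundMeasure n k).real {v | ¬ FollowsMean δ x v} ≤ 4 * Real.exp (-(δ ^ 2 * n / 2)) := by
  have hn : (0 : ℝ) < n := by exact_mod_cast Nat.pos_of_ne_zero (NeZero.ne n)
  have hk : (0 : ℝ) ≤ k := Nat.cast_nonneg k
  have hN : (0 : ℝ) < n + 3 * k := by positivity
  have hs := measure_abs_ge_le (hasSubgaussianMGF_sum_pi (n := n)
    (PMF.uniformOfFintype (Node n k)).toMeasure
    (fun u a => (Opinion.update (x u) (nodeState x a)).sign) (fun u a => by
      cases Opinion.update (x u) (nodeState x a) <;> norm_num [Opinion.sign]))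
    (ε := δ * (n + 3 * k)) (by positivity)
  have hd := measure_abs_ge_le (hasSubgaussianMGF_sum_pi (n := n)
    (PMF.uniformOfFintype (Node n k)).toMeasure
    (fun u a => (Opinion.update (x u) (nodeState x a)).undecidedIndicator) (fun u a => by
      cases Opinion.update (x u) (nodeState x a) <;> norm_num [Opinion.undecidedIndicator]))
    (ε := δ * (n + 3 * k)) (by positivity)
  have hexp : Real.exp (-(δ * (n + 3 * k)) ^ 2 / (2 * ((n : NNReal) : ℝ))) ≤
      Real.exp (-(δ ^ 2 * n / 2)) := by
    rw [Real.exp_le_exp, NNReal.coe_natCast, neg_div, neg_le_neg_iff, le_div_iff₀ (by positivity),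
      mul_pow]
    have : (n : ℝ) * n ≤ (n + 3 * k) ^ 2 := by nlinarith
    nlinarith [sq_nonneg δ]
  refine le_trans (measureReal_mono (fun v hv => ?_)) ((measureReal_union_le _ _).trans
    ((add_le_add hs hd).trans (by linarith)))
  simp only [FollowsMean, Set.mem_ofPred_eq, not_and_or, not_le] at hv
  refine hv.imp (fun h => ?_) fun h => ?_
  · rw [← sum_integral_sign, relBias, ← sub_div, abs_div, abs_of_pos hN, lt_div_iff₀ hN,
      bias_eq_sum] at h
    exact h.le
  · rw [← sum_integral_undecidedIndicator, relExcess, ← sub_div, abs_div, abs_of_pos hN,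
      lt_div_iff₀ hN, count_undecided_eq_sum, sub_sub_sub_cancel_right] at h
    exact h.le

/-- The stubborn agents alone keep every agent random: in each state, pulling them leads to at least
two signs at distance 1, each with probability at least k/N, and (1 - c)² + c² ≥ 1/2. -/
theorem le_integral_sign_sub_sq {n k : ℕ} [NeZero n] (x : Config n) (o : Opinion) (c : ℝ) :
    k / (n + 3 * k) / 2 ≤ ∫ a, ((Opinion.update o (nodeState x a)).sign - c) ^ 2
        ∂(PMF.uniformOfFintype (Node n k)).toMeasure := by
  have hn : (0 : ℝ) < n := by exact_mod_cast Nat.pos_of_ne_zero (NeZero.ne n)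
  have hk : (0 : ℝ) ≤ k := Nat.cast_nonneg k
  have hN : (0 : ℝ) < n + 3 * k := by positivity
  rw [integral_nodeState x fun o' => ((Opinion.update o o').sign - c) ^ 2, div_right_comm]
  gcongr
  have ha := count_nonneg x .alpha
  have hb := count_nonneg x .beta
  have hq := count_nonneg x .undecided
  cases o <;> simp only [Opinion.update, Opinion.sign]
  · nlinarith [mul_nonneg ha (sq_nonneg (1 - c)), mul_nonneg hb (sq_nonneg (0 - c)),
      mul_nonneg hq (sq_nonneg (1 - c)), mul_nonneg hk (sq_nonneg (1 - 2 * c)),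
      mul_nonneg hk (sq_nonneg (1 - c))]
  · nlinarith [mul_nonneg ha (sq_nonneg (0 - c)), mul_nonneg hb (sq_nonneg (-1 - c)),
      mul_nonneg hq (sq_nonneg (-1 - c)), mul_nonneg hk (sq_nonneg (1 + 2 * c)),
      mul_nonneg hk (sq_nonneg (-1 - c))]
  · nlinarith [mul_nonneg ha (sq_nonneg (1 - c)), mul_nonneg hb (sq_nonneg (-1 - c)),
      mul_nonneg hq (sq_nonneg (0 - c)), mul_nonneg hk (sq_nonneg c)]

theorem integral_sub_integral_sq_le_one {Ω : Type*} [MeasurableSpace Ω] [Finite Ω]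
    [DiscreteMeasurableSpace Ω] {μ : Measure Ω} [IsProbabilityMeasure μ] {X : Ω → ℝ}
    (h : ∀ ω, X ω ∈ Set.Icc (-1 : ℝ) 1) : ∫ ω, (X ω - ∫ ω', X ω' ∂μ) ^ 2 ∂μ ≤ 1 := by
  rw [← variance_eq_integral (Measurable.of_discrete).aemeasurable]
  refine (variance_le_sub_mul_sub (Filter.Eventually.of_forall h)
    (Measurable.of_discrete).aemeasurable).trans ?_
  nlinarith [sq_nonneg (∫ ω, X ω ∂μ)]

theorem integral_one_div_bias_le {n k : ℕ} [NeZero n] {v κ η : ℝ} (hv : 0 < v) (hv1 : v ≤ 1)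
    (hη : 0 < η) (hη1 : η ≤ v / 800) (hη2 : 208 * η ≤ κ) (hvk : v ≤ k / (n + 3 * k) / 2)
    (x : Config n) (hx : 1 ≤ (1 - 17 * κ) * (1 + growthRate n k + relExcess k x) ^ 2) :
    ∫ w, 1 / (n + η * (bias (stepConfig x w) : ℝ) ^ 2) ∂(roundMeasure n k) ≤
      (1 - η * v / 8) / (n + η * (bias x : ℝ) ^ 2) := by
  have hn0 : 0 < n := Nat.pos_of_ne_zero (NeZero.ne n)
  have hn : (0 : ℝ) < n := by exact_mod_cast hn0
  have hN : (0 : ℝ) < n + 3 * k := by positivity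
  set μ := (PMF.uniformOfFintype (Node n k)).toMeasure with hμ
  set f : Fin n → Node n k → ℝ := fun u a => (Opinion.update (x u) (nodeState x a)).sign with hf
  have hf1 : ∀ u a, f u a ∈ Set.Icc (-1 : ℝ) 1 := fun u a => by
    simp only [hf]
    cases Opinion.update (x u) (nodeState x a) <;> norm_num [Opinion.sign]
  have hb : ∀ w, (bias (stepConfig x w) : ℝ) = ∑ u, f u (w u) := fun w => bias_eq_sum _
  simp_rw [hb]
  have hm : ∑ u, ∫ a, f u a ∂μ = bias x * (1 + growthRate n k + relExcess k x) := by
    have := sum_integral_sign (k := k) x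
    rw [div_eq_iff hN.ne'] at this
    rw [this, relBias]
    field_simp
  refine integral_one_div_le (m := ∑ u, ∫ a, f u a ∂μ) hn hv hv1 hη hη1 hη2 ?_
    (integral_sum_pi μ f) ?_ ?_ (integral_pow_four_le hn0 (hasSubgaussianMGF_sum_pi μ f hf1))
  · rw [hm]
    nlinarith [sq_nonneg (bias x : ℝ)]
  · rw [roundMeasure, integral_sq_sum_pi]
    calc v * n = ∑ _u : Fin n, v := by simp [mul_comm]
      _ ≤ _ := Finset.sum_le_sum fun u _ => hvk.trans (le_integral_sign_sub_sq x (x u) _)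
  · rw [roundMeasure, integral_sq_sum_pi]
    calc _ ≤ ∑ _u : Fin n, (1 : ℝ) :=
          Finset.sum_le_sum fun u _ => integral_sub_integral_sq_le_one (hf1 u)
      _ = n := by simp

/-! ### Deterministic recursions with bounded errors -/

theorem le_geometric_add {u : ℕ → ℝ} {q b : ℝ} (hq : 0 ≤ q) (hq1 : q < 1) (hb : 0 ≤ b) {L : ℕ}
    (h : ∀ i < L, u (i + 1) ≤ q * u i + b) : ∀ i ≤ L, u i ≤ q ^ i * u 0 + b / (1 - q) := by
  intro i
  induction i with
  | zero =>
    intro _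
    have : 0 ≤ b / (1 - q) := div_nonneg hb (by linarith)
    simpa using this
  | succ i ih =>
    intro hi
    have h1 := h i (by omega)
    have h2 := ih (by omega)
    have h3 : q * (b / (1 - q)) + b = b / (1 - q) := by
      have : (1 - q) ≠ 0 := by linarith
      field_simp; ring
    calc u (i + 1) ≤ q * u i + b := h1
      _ ≤ q * (q ^ i * u 0 + b / (1 - q)) + b := by gcongr
      _ = q ^ (i + 1) * u 0 + (q * (b / (1 - q)) + b) := by ring
      _ = _ := by rw [h3]

/-- A region of configurations with a large bias that is never left while the dynamics follows
its mean. -/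
def InPhase (ρ s d : ℝ) : Prop := 4 / 5 * ρ ≤ s ∨ 3 / 5 * ρ ≤ s ∧ -(ρ / 2) ≤ d

theorem InPhase.le {ρ s d : ℝ} (hρ : 0 < ρ) (h : InPhase ρ s d) : 3 / 5 * ρ ≤ s := by
  rcases h with h | h
  · linarith
  · exact h.1

/-- The term (3/2)d² is nonnegative, so one round with a small bias repairs any shortage of
undecided agents, whatever d was. -/
theorem excess_ge_of_small {ρ s d d' : ℝ} (hρ : 0 < ρ) (hρ1 : ρ ≤ 1 / 3) (hs : |s| ≤ ρ)
    (hd' : |d' - (3 / 2 * d ^ 2 - s ^ 2 / 2)| ≤ ρ ^ 2 / 30) : -(ρ / 2) ≤ d' := by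
  have h1 := (abs_le.1 hd').1
  have h2 : s ^ 2 ≤ ρ ^ 2 := sq_le_sq' (abs_le.1 hs).1 (abs_le.1 hs).2
  nlinarith [sq_nonneg d]

/-- In one round s can lose at most the factor 5/6, up to the error. From s > ρ it stays above 4ρ/5.
From s ≤ ρ the new excess is at least -ρ/2, and s stays above 3ρ/5: one loss from 4ρ/5 allows it,
and when d ≥ -ρ/2 already, the factor is at least 1 + ρ/2 and its gain covers the error. -/
theorem InPhase.step {ρ g s d s' d' : ℝ} (hρ : 0 < ρ) (hρ1 : ρ ≤ 1 / 3) (hg : ρ ≤ g)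
    (hf : 5 / 6 ≤ 1 + g + d) (hs' : |s' - s * (1 + g + d)| ≤ ρ ^ 2 / 30)
    (hd' : |d' - (3 / 2 * d ^ 2 - s ^ 2 / 2)| ≤ ρ ^ 2 / 30) (h : InPhase ρ s d) :
    InPhase ρ s' d' := by
  have hs0 := h.le hρ
  have h1 := (abs_le.1 hs').1
  have hρ2 : ρ ^ 2 / 30 ≤ ρ / 90 := by nlinarith
  rcases le_or_gt ρ s with hc | hc
  · left
    nlinarith
  · right
    refine ⟨?_, excess_ge_of_small hρ hρ1 (abs_le.2 ⟨by linarith, hc.le⟩) hd'⟩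
    rcases h with h | h
    · nlinarith
    · nlinarith

theorem InPhase.forall_le {ρ g : ℝ} {s d : ℕ → ℝ} {T L : ℕ} (hρ : 0 < ρ) (hρ1 : ρ ≤ 1 / 3)
    (hg : ρ ≤ g) (hf : ∀ t, 5 / 6 ≤ 1 + g + d t)
    (hs : ∀ t < L, |s (t + 1) - s t * (1 + g + d t)| ≤ ρ ^ 2 / 30)
    (hd : ∀ t < L, |d (t + 1) - (3 / 2 * d t ^ 2 - s t ^ 2 / 2)| ≤ ρ ^ 2 / 30)
    (h : InPhase ρ (s T) (d T)) : ∀ t, T ≤ t → t ≤ L → InPhase ρ (s t) (d t) := by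
  intro t ht
  induction t, ht using Nat.le_induction with
  | base => exact fun _ => h
  | succ t _ ih =>
    intro hL
    exact (ih (by omega)).step hρ hρ1 hg (hf t) (hs t (by omega)) (hd t (by omega))

/-- A lack of undecided agents is created only by the bias of the round before, of which at least
two thirds survive up to δ. -/
theorem neg_excess_le {f s d s' d' δ : ℝ} (hf : 2 / 3 ≤ f) (hs : |s| ≤ 1 / 2) (hδ : 0 ≤ δ)
    (hs' : |s' - s * f| ≤ δ) (hd' : |d' - (3 / 2 * d ^ 2 - s ^ 2 / 2)| ≤ δ) :
    -d' ≤ 3 / 8 * |s'| + 2 * δ := by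
  have h1 := (abs_le.1 hd').1
  have h2 : |s| * f ≤ |s'| + δ := by
    calc |s| * f = |s * f| := by rw [abs_mul, abs_of_nonneg (by linarith : 0 ≤ f)]
      _ ≤ |s'| + |s' - s * f| := by
          have := abs_sub_abs_le_abs_sub (s * f) s'
          rw [abs_sub_comm] at this
          linarith
      _ ≤ _ := by gcongr
  have h3 : |s| * (2 / 3) ≤ |s| * f := by gcongr
  have h4 : s ^ 2 ≤ |s| * (1 / 2) := by
    rw [← sq_abs, sq]; gcongr
  nlinarith [sq_nonneg d]

/-- For d ≥ 0, (3/2)d² ≤ d/2 because d ≤ 1/3. For d < 0 the danger is that d² rebounds to a large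
positive excess; but (3/2)(3/8)² < 1/2, so -s²/2 absorbs it up to O(δ). -/
theorem excess_le {s d d' δ : ℝ} (hs : |s| ≤ 1 / 2) (hδ : 0 ≤ δ) (hδ1 : δ ≤ 1)
    (hd : d ≤ 1 / 3) (hds : -d ≤ 3 / 8 * |s| + 2 * δ)
    (hd' : |d' - (3 / 2 * d ^ 2 - s ^ 2 / 2)| ≤ δ) : max d' 0 ≤ 1 / 2 * max d 0 + 9 * δ := by
  have h1 := (abs_le.1 hd').2
  have hm := le_max_left d 0
  have hm0 := le_max_right d 0
  refine max_le ?_ (by positivity)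
  rcases le_or_gt 0 d with h | h
  · nlinarith [sq_nonneg s]
  · have h2 : d ^ 2 ≤ (3 / 8 * |s| + 2 * δ) ^ 2 := sq_le_sq' (by linarith) (by linarith)
    have h3 : |s| * δ ≤ 1 / 2 * δ := by gcongr
    have h4 : δ * δ ≤ 1 * δ := by gcongr
    nlinarith [sq_abs s, abs_nonneg s]

theorem bias_small_of_followsMean {r g δ : ℝ} {s d : ℕ → ℝ} {j I L : ℕ} (hr : 0 < r) (hr1 : r < 1)
    (hg : g ≤ -(2 * r)) (hf : ∀ t, 2 / 3 ≤ 1 + g + d t) (hs1 : ∀ t, |s t| ≤ 1 / 2)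
    (hd1 : ∀ t, d t ≤ 1 / 3) (hδ : 0 ≤ δ) (hδ1 : δ ≤ 1) (hδr : 36 * δ ≤ r)
    (hj : (1 / 2 : ℝ) ^ j ≤ r) (hI : (1 - r) ^ I ≤ δ)
    (hs : ∀ t < L, |s (t + 1) - s t * (1 + g + d t)| ≤ δ)
    (hd : ∀ t < L, |d (t + 1) - (3 / 2 * d t ^ 2 - s t ^ 2 / 2)| ≤ δ) :
    ∀ t, 1 + j + I ≤ t → t ≤ L → |s t| ≤ (1 + 1 / r) * δ := by
  have hexc : ∀ i, 1 + i ≤ L → max (d (1 + i)) 0 ≤ (1 / 2) ^ i * max (d 1) 0 + 18 * δ := by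
    intro i hi
    -- The recursion starts in round 1, since the lower bound on d comes from a preceding round.
    have := le_geometric_add (u := fun i => max (d (1 + i)) 0) (q := 1 / 2) (b := 9 * δ)
      (L := L - 1) (by norm_num) (by norm_num) (by positivity) (fun i hi => by
        refine excess_le (hs1 _) hδ hδ1 (hd1 _) ?_ (hd (1 + i) (by omega))
        rw [add_comm 1 i]
        exact neg_excess_le (hf i) (hs1 i) hδ (hs i (by omega)) (hd i (by omega))) i (by omega)
    calc _ ≤ _ := this
      _ = _ := by norm_num; ring
  have hsmall : ∀ i, j ≤ i → 1 + i ≤ L → d (1 + i) ≤ r := by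
    intro i hji hi
    have h1 : (1 / 2 : ℝ) ^ i ≤ r :=
      (pow_le_pow_of_le_one (by norm_num) (by norm_num) hji).trans hj
    have h2 : max (d 1) 0 ≤ 1 / 3 := max_le (hd1 1) (by norm_num)
    have h3 : (1 / 2 : ℝ) ^ i * max (d 1) 0 ≤ r * (1 / 3) := by gcongr
    linarith [hexc i hi, le_max_left (d (1 + i)) 0]
  intro t ht htL
  -- Once d ≤ r, the growth factor 1 + g + d is at most 1 - 2r + r = 1 - r.
  have hmain := le_geometric_add (u := fun i => |s (1 + j + i)|) (q := 1 - r) (b := δ)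
    (L := L - (1 + j)) (by linarith) (by linarith) hδ (fun i hi => by
      have h1 := hs (1 + j + i) (by omega)
      have h2 : d (1 + j + i) ≤ r := by
        rw [add_assoc]; exact hsmall (j + i) (by omega) (by omega)
      have h3 := abs_sub_abs_le_abs_sub (s (1 + j + i + 1)) (s (1 + j + i) * (1 + g + d (1 + j + i)))
      rw [abs_mul, abs_of_nonneg (by linarith [hf (1 + j + i)] : 0 ≤ 1 + g + d (1 + j + i))] at h3
      have h4 : |s (1 + j + i)| * (1 + g + d (1 + j + i)) ≤ |s (1 + j + i)| * (1 - r) := by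
        gcongr; linarith
      have h5 : 1 + j + (i + 1) = 1 + j + i + 1 := by omega
      rw [h5]
      linarith) (t - (1 + j)) (by omega)
  have ht' : 1 + j + (t - (1 + j)) = t := by omega
  simp only [ht'] at hmain
  have h1 : (1 - r) ^ (t - (1 + j)) ≤ δ :=
    (pow_le_pow_of_le_one (by linarith) (by linarith) (by omega)).trans hI
  have h2 : (1 - r) ^ (t - (1 + j)) * |s (1 + j + 0)| ≤ δ * 1 := by
    gcongr
    linarith [hs1 (1 + j + 0)]
  calc |s t| ≤ _ := hmain
    _ ≤ δ * 1 + δ / (1 - (1 - r)) := by gcongr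
    _ = _ := by rw [sub_sub_cancel]; ring

/-! ### Rounding of k, escape from a small bias, and failure probabilities -/

theorem abs_stubborn_fraction_sub_le {n k : ℕ} [NeZero n] {p : ℝ} (hp0 : 0 < p) (hp : p < 1 / 3)
    (hk : |(k : ℝ) - p / (1 - 3 * p) * n| < 1) : |(k : ℝ) / (n + 3 * k) - p| ≤ 1 / n := by
  have hn : (0 : ℝ) < n := by exact_mod_cast Nat.pos_of_ne_zero (NeZero.ne n)
  have hk0 : (0 : ℝ) ≤ k := Nat.cast_nonneg k
  have hN : (0 : ℝ) < n + 3 * k := by positivity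
  have h3 : 0 < 1 - 3 * p := by linarith
  have he : (k : ℝ) / (n + 3 * k) - p =
      (1 - 3 * p) * (k - p / (1 - 3 * p) * n) / (n + 3 * k) := by
    field_simp; ring
  rw [he, abs_div, abs_of_pos hN, abs_mul, abs_of_pos h3]
  have : (1 - 3 * p) * |(k : ℝ) - p / (1 - 3 * p) * n| ≤ 1 * 1 := by
    gcongr; linarith
  gcongr <;> linarith

theorem ordinary_fraction (n k : ℕ) [NeZero n] :
    (n : ℝ) / (n + 3 * k) = 1 - 3 * (k / (n + 3 * k)) := by
  have hn : (0 : ℝ) < n := by exact_mod_cast Nat.pos_of_ne_zero (NeZero.ne n)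
  have hN : (0 : ℝ) < n + 3 * k := by positivity
  field_simp; ring

theorem one_sub_stubborn_fraction_le {n k : ℕ} [NeZero n] (x : Config n) :
    1 - (k : ℝ) / (n + 3 * k) ≤ 1 + growthRate n k + relExcess k x := by
  have h := neg_le_relExcess (k := k) x
  rw [ordinary_fraction] at h
  rw [growthRate]
  linarith

theorem one_sub_le_measureReal {Ω : Type*} [MeasurableSpace Ω] {μ : Measure Ω}
    [IsProbabilityMeasure μ] {S B : Set Ω} {b : ℝ} (h : ∀ ω, ω ∉ B → ω ∈ S) (hB : μ.real B ≤ b) :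
    1 - b ≤ μ.real S := by
  have h1 : (1 : ℝ) = μ.real (S ∪ B) := by
    have : S ∪ B = Set.univ := by
      ext ω
      by_cases hω : ω ∈ B
      · simp [hω]
      · simp [h ω hω]
    rw [this, probReal_univ]
  linarith [measureReal_union_le (μ := μ) S B]

theorem measure_exists_not_followsMean_le {n k : ℕ} [NeZero n] {δ : ℝ} (hδ : 0 ≤ δ) (L : ℕ)
    (x : Config n) :
    (choiceMeasure n k).real
      {ω | ∃ t < L, ¬ FollowsMean δ (stubbornProcess x ω t) fun u => ω (t, u)} ≤
      L * (4 * Real.exp (-(δ ^ 2 * n / 2))) := by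
  have h := measure_exists_round_le (n := n) (k := k) (fun x v => ¬ FollowsMean δ x v)
    (ENNReal.ofReal (4 * Real.exp (-(δ ^ 2 * n / 2))))
    (fun x => by
      rw [← ENNReal.ofReal_toReal (measure_ne_top _ _)]
      exact ENNReal.ofReal_le_ofReal (measure_not_followsMean_le hδ x)) L x
  have h2 := ENNReal.toReal_mono (by finiteness) h
  rwa [ENNReal.toReal_mul, ENNReal.toReal_natCast, ENNReal.toReal_ofReal (by positivity)] at h2

theorem abs_bias_le {n : ℕ} (x : Config n) : |(bias x : ℝ)| ≤ n := by
  have h := sum_count x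
  have ha := count_nonneg x .alpha
  have hb := count_nonneg x .beta
  have hc := count_nonneg x .undecided
  rw [bias_eq_count, abs_le]
  constructor <;> linarith

theorem measure_forall_small_bias_le {n k : ℕ} [NeZero n] {v ρ η : ℝ} (hv : 0 < v) (hv1 : v ≤ 1)
    (hρ : 0 < ρ) (hρ1 : ρ ≤ 1) (hη : 0 < η) (hη1 : η ≤ v / 800) (hη2 : 208 * η ≤ ρ / 34)
    (hvk : v ≤ k / (n + 3 * k) / 2) (hg : ρ ≤ growthRate n k) (T : ℕ) (x : Config n) :
    (choiceMeasure n k).real {ω | ∀ t ≤ T, stubbornProcess x ω (t + 1) ∈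
      {y : Config n | |relBias k y| < ρ ∧ -(ρ / 2) ≤ relExcess k y}} ≤
      (1 - η * v / 8) ^ T * (2 * n) := by
  have hn1 : (1 : ℝ) ≤ n := by exact_mod_cast Nat.one_le_iff_ne_zero.2 (NeZero.ne n)
  have hn : (0 : ℝ) < n := by linarith
  have hr : 0 ≤ 1 - η * v / 8 := by nlinarith
  -- The normalisation makes φ at least 1 everywhere, as |bias| ≤ n, and at most 1 + ηn ≤ 2n.
  set φ : Config n → ℝ := fun y => (n + η * (n : ℝ) ^ 2) * (1 / (n + η * (bias y : ℝ) ^ 2)) with hφ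
  have hφ0 : ∀ y, 0 ≤ φ y := fun y => by positivity
  have h := measure_forall_mem_succ_le (k := k)
    {y : Config n | |relBias k y| < ρ ∧ -(ρ / 2) ≤ relExcess k y}
    (fun y => ENNReal.ofReal (φ y)) (ENNReal.ofReal (1 - η * v / 8)) (ENNReal.ofReal (2 * n))
    (fun y _ => by
      rw [← ENNReal.ofReal_one]
      refine ENNReal.ofReal_le_ofReal ?_
      simp only [hφ]
      rw [mul_one_div, one_le_div (by positivity)]
      have : (bias y : ℝ) ^ 2 ≤ (n : ℝ) ^ 2 := sq_le_sq' (abs_le.1 (abs_bias_le y)).1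
        (abs_le.1 (abs_bias_le y)).2
      gcongr)
    (fun y => by
      refine ENNReal.ofReal_le_ofReal ?_
      simp only [hφ]
      rw [mul_one_div, div_le_iff₀ (by positivity)]
      have : 0 ≤ η * (bias y : ℝ) ^ 2 := by positivity
      have : η * (n : ℝ) ^ 2 ≤ 1 * (n : ℝ) ^ 2 := by gcongr; linarith
      nlinarith)
    (fun y hy => by
      rw [← ofReal_integral_eq_lintegral_ofReal Integrable.of_finite
        (Filter.Eventually.of_forall fun w => hφ0 _), ← ENNReal.ofReal_mul hr]
      refine ENNReal.ofReal_le_ofReal ?_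
      simp only [hφ]
      rw [integral_const_mul]
      have hf : 1 + ρ / 2 ≤ 1 + growthRate n k + relExcess k y := by linarith [hy.2]
      have h1 := integral_one_div_bias_le (κ := ρ / 34) hv hv1 hη hη1 hη2 hvk y (by
        have h2 : (1 + ρ / 2) ^ 2 ≤ (1 + growthRate n k + relExcess k y) ^ 2 := by gcongr
        have h3 : 0 ≤ 1 - 17 * (ρ / 34) := by linarith
        -- The difference of the two sides is ρ(4 - 2ρ - ρ²)/8.
        have h4 : 1 ≤ (1 - 17 * (ρ / 34)) * (1 + ρ / 2) ^ 2 := by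
          nlinarith [mul_nonneg hρ.le (by nlinarith : 0 ≤ 4 - 2 * ρ - ρ ^ 2)]
        exact h4.trans (by gcongr))
      calc (n + η * (n : ℝ) ^ 2) * ∫ w, 1 / (n + η * (bias (stepConfig y w) : ℝ) ^ 2)
            ∂(roundMeasure n k)
          ≤ (n + η * (n : ℝ) ^ 2) * ((1 - η * v / 8) / (n + η * (bias y : ℝ) ^ 2)) := by gcongr
        _ = _ := by ring) T x
  have h2 := ENNReal.toReal_mono (by finiteness) h
  rwa [ENNReal.toReal_mul, ENNReal.toReal_pow, ENNReal.toReal_ofReal hr,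
    ENNReal.toReal_ofReal (by positivity)] at h2

theorem bias_eq_relBias_mul {n : ℕ} (k : ℕ) [NeZero n] (x : Config n) :
    (bias x : ℝ) = relBias k x * (n + 3 * k) := by
  have hn : (0 : ℝ) < n := by exact_mod_cast Nat.pos_of_ne_zero (NeZero.ne n)
  have hN : (0 : ℝ) < n + 3 * k := by positivity
  rw [relBias, div_mul_cancel₀ _ hN.ne']

theorem ceil_add_le_mul_log {a : ℝ} (ha : 0 ≤ a) (m : ℕ) {n : ℕ} (hn : 1 ≤ Real.log n) :
    ((⌈a * Real.log n⌉₊ + m : ℕ) : ℝ) ≤ (a + 1 + m) * Real.log n := by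
  have h1 := (Nat.ceil_lt_add_one (mul_nonneg ha (by linarith : 0 ≤ Real.log n))).le
  have h2 : (0 : ℝ) ≤ m := Nat.cast_nonneg m
  push_cast
  nlinarith

theorem one_sub_pow_ceil_le {a c : ℝ} (ha : 0 < a) (ha1 : a ≤ 1) {n : ℕ} (hn : 0 < n) :
    (1 - a) ^ ⌈c / a * Real.log n⌉₊ ≤ (n : ℝ) ^ (-c) := by
  have hn' : (0 : ℝ) < n := by exact_mod_cast hn
  calc (1 - a) ^ ⌈c / a * Real.log n⌉₊ ≤ Real.exp (-a) ^ ⌈c / a * Real.log n⌉₊ := by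
        refine pow_le_pow_left₀ (by linarith) ?_ _
        linarith [Real.add_one_le_exp (-a)]
    _ = Real.exp (-(a * ⌈c / a * Real.log n⌉₊)) := by
        rw [← Real.exp_nat_mul]; ring_nf
    _ ≤ Real.exp (-(a * (c / a * Real.log n))) := by
        gcongr; exact Nat.le_ceil _
    _ = (n : ℝ) ^ (-c) := by
        rw [Real.rpow_def_of_pos hn']
        congr 1
        field_simp

/-- The region can be left through a large bias or through a low excess; the latter is impossible
right after a round with |s| < ρ. -/
theorem exists_abs_relBias_ge {n k : ℕ} [NeZero n] {ρ : ℝ} {x : ℕ → Config n} {T L : ℕ}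
    (hρ : 0 < ρ) (hρ1 : ρ ≤ 1 / 3) (hTL : T < L)
    (hd : ∀ t < L, |relExcess k (x (t + 1)) -
      (3 / 2 * relExcess k (x t) ^ 2 - relBias k (x t) ^ 2 / 2)| ≤ ρ ^ 2 / 30)
    (h : ¬ ∀ t ≤ T, |relBias k (x (t + 1))| < ρ ∧ -(ρ / 2) ≤ relExcess k (x (t + 1))) :
    ∃ t ≤ T + 1, ρ ≤ |relBias k (x t)| := by
  push Not at h
  obtain ⟨t, ht, h⟩ := h
  rcases le_or_gt ρ |relBias k (x t)| with h0 | h0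
  · exact ⟨t, by omega, h0⟩
  · refine ⟨t + 1, by omega, ?_⟩
    by_contra! h1
    exact absurd (excess_ge_of_small hρ hρ1 h0.le (hd t (by omega))) (not_le.2 (h h1))

/-- A large bias towards an opinion persists while the dynamics follows its mean. -/
theorem bias_persists {n k : ℕ} [NeZero n] {ρ e : ℝ} {x : ℕ → Config n} {T L : ℕ}
    (he : e = 1 ∨ e = -1) (hρ : 0 < ρ) (hρ1 : ρ ≤ 1 / 3) (hg : ρ ≤ growthRate n k)
    (hs : ∀ t < L, |relBias k (x (t + 1)) -
      relBias k (x t) * (1 + growthRate n k + relExcess k (x t))| ≤ ρ ^ 2 / 30)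
    (hd : ∀ t < L, |relExcess k (x (t + 1)) -
      (3 / 2 * relExcess k (x t) ^ 2 - relBias k (x t) ^ 2 / 2)| ≤ ρ ^ 2 / 30)
    (h : ρ ≤ e * relBias k (x T)) (t : ℕ) (ht : T ≤ t) (htL : t ≤ L) :
    3 / 5 * ρ * n ≤ e * bias (x t) ∧ e * bias (x t) ≤ 1 * n := by
  have he2 : e ^ 2 = 1 := by rcases he with rfl | rfl <;> norm_num
  have he1 : |e| = 1 := by rcases he with rfl | rfl <;> norm_num
  have hk0 : (0 : ℝ) ≤ k := Nat.cast_nonneg k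
  have hn0 : (0 : ℝ) ≤ n := Nat.cast_nonneg n
  -- Multiplying s by the sign e preserves both recursions, since the one for d contains only s².
  have hR := InPhase.forall_le (g := growthRate n k) (s := fun t => e * relBias k (x t))
    (d := fun t => relExcess k (x t)) (T := T) (L := L) hρ hρ1 hg (fun t => by
      have h1 := one_sub_stubborn_fraction_le (k := k) (x t)
      rw [growthRate] at hg h1 ⊢
      linarith) (fun t ht => by
      rw [mul_assoc, ← mul_sub, abs_mul, he1, one_mul]
      exact hs t ht) (fun t ht => by
      simp only [mul_pow, he2, one_mul]
      exact hd t ht) (Or.inl (by linarith)) t ht htL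
  have h1 := hR.le hρ
  refine ⟨?_, ?_⟩
  · rw [bias_eq_relBias_mul k, ← mul_assoc]
    have : (0 : ℝ) ≤ n + 3 * k := by positivity
    calc 3 / 5 * ρ * n ≤ 3 / 5 * ρ * (n + 3 * k) := by gcongr; linarith
      _ ≤ _ := by gcongr
  · rw [one_mul]
    calc e * (bias (x t) : ℝ) ≤ |e * (bias (x t) : ℝ)| := le_abs_self _
      _ = |(bias (x t) : ℝ)| := by rw [abs_mul, he1, one_mul]
      _ ≤ n := abs_bias_le _

theorem entersPhase_of_forall {n : ℕ} {X : ℕ → Config n} {start : ℝ} {P : ℤ → Prop} {T L : ℕ}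
    (hT : (T : ℝ) ≤ start) (hL : T + n ≤ L) (h : ∀ t, T ≤ t → t ≤ L → P (bias (X t))) :
    EntersPhase X start (1 * (n : ℝ) ^ (1 : ℝ)) P := by
  refine ⟨T, hT, fun t ht htL => h t ht (le_trans ?_ hL)⟩
  rw [Real.rpow_one, one_mul] at htL
  exact_mod_cast htL

theorem exp_neg_le (y : ℝ) (hy : 0 < y) : Real.exp (-y) ≤ 6 / y ^ 3 := by
  have h := Real.pow_div_factorial_le_exp y hy.le 3
  have h6 : ((Nat.factorial 3 : ℕ) : ℝ) = 6 := by norm_num [Nat.factorial]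
  rw [h6] at h
  rw [Real.exp_neg, ← inv_div]
  gcongr

/-- Here A counts the rounds, y bounds the failure of a single round to follow its mean, and z
bounds the failure to escape. -/
theorem failure_le {A C K y z : ℝ} {n : ℕ} (hn : 0 < (n : ℝ)) (hA : A ≤ C * n) (hA0 : 0 ≤ C)
    (hy : y ≤ K / (n : ℝ) ^ 3) (hy0 : 0 ≤ y) (hz : z ≤ 2 * n / (n : ℝ) ^ 3)
    (hK : C * K + 2 ≤ n) : A * y + z ≤ (n : ℝ) ^ (-(1 : ℝ)) := by
  rw [Real.rpow_neg_one]
  calc A * y + z ≤ C * n * (K / (n : ℝ) ^ 3) + 2 * n / (n : ℝ) ^ 3 := by gcongr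
    _ = (C * K + 2) * (1 / (n : ℝ) ^ 2) := by field_simp
    _ ≤ n * (1 / (n : ℝ) ^ 2) := by gcongr
    _ = (n : ℝ)⁻¹ := by field_simp

theorem one_le_log_of_three_le {n : ℕ} (hn : 3 ≤ n) : 1 ≤ Real.log n := by
  have h3 : (3 : ℝ) ≤ n := by exact_mod_cast hn
  rw [Real.le_log_iff_exp_le (by linarith)]
  linarith [Real.exp_one_lt_d9]

/-! ### The two regimes -/

theorem exists_phase_large_bias {p : ℝ} (hp0 : 0 < p) (hp : p < 1 / 6) :
    ∃ C > (0 : ℝ), ∃ c > (0 : ℝ), ∃ lam > (0 : ℝ), ∃ c₁ > (0 : ℝ), ∃ c₂ > (0 : ℝ),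
      ∃ γ > (0 : ℝ), ∃ n₀ : ℕ, ∀ (n : ℕ) [NeZero n], n₀ ≤ n →
        ∀ k : ℕ, |(k : ℝ) - p / (1 - 3 * p) * n| < 1 → ∀ x : Config n,
          1 - (n : ℝ) ^ (-γ) ≤ (choiceMeasure n k).real
            {ω | EntersPhase (stubbornProcess x ω) (C * Real.log n) (c * (n : ℝ) ^ lam)
                  (fun s => c₁ * n ≤ (s : ℝ) ∧ (s : ℝ) ≤ c₂ * n) ∨
                EntersPhase (stubbornProcess x ω) (C * Real.log n) (c * (n : ℝ) ^ lam)
                  (fun s => c₁ * n ≤ -(s : ℝ) ∧ -(s : ℝ) ≤ c₂ * n)} := by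
  -- Half of the limiting growth rate; the other half absorbs the rounding of k, which moves g by at
  -- most 2/n.
  obtain ⟨ρ, hρdef⟩ : ∃ ρ, ρ = (1 / 3 - 2 * p) / 2 := ⟨_, rfl⟩
  have hρ : 0 < ρ := by linarith
  have hρ1 : ρ ≤ 1 / 3 := by linarith
  obtain ⟨v, hvdef⟩ : ∃ v, v = p / 4 := ⟨_, rfl⟩
  have hv : 0 < v := by linarith
  have hv1 : v ≤ 1 := by linarith
  obtain ⟨η, hη, hη1, hη2⟩ : ∃ η : ℝ, 0 < η ∧ η ≤ v / 800 ∧ 208 * η ≤ ρ / 34 :=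
    ⟨min (v / 800) (ρ / 34 / 208), by positivity, min_le_left _ _, by
      linarith [min_le_right (v / 800) (ρ / 34 / 208)]⟩
  obtain ⟨a, hadef⟩ : ∃ a, a = η * v / 8 := ⟨_, rfl⟩
  have ha : 0 < a := by rw [hadef]; positivity
  have ha1 : a ≤ 1 := by rw [hadef]; nlinarith
  obtain ⟨b, hbdef⟩ : ∃ b, b = (ρ ^ 2 / 30) ^ 2 / 2 := ⟨_, rfl⟩
  have hb : 0 < b := by rw [hbdef]; positivity
  obtain ⟨C, hCdef⟩ : ∃ C : ℝ, C = 3 / a + 1 + (1 : ℕ) := ⟨_, rfl⟩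
  have hC : 0 < C := by rw [hCdef]; positivity
  refine ⟨C, hC, 1, one_pos, 1, one_pos, 3 / 5 * ρ, by positivity, 1, one_pos, 1, one_pos,
    max 3 (max ⌈2 / ρ⌉₊ (max ⌈2 / p⌉₊ ⌈(C + 1) * (4 * (6 / b ^ 3)) + 2⌉₊)), ?_⟩
  intro n _ hn k hk x
  simp only [max_le_iff, Nat.ceil_le] at hn
  obtain ⟨hn3, hnρ, hnp, hnK⟩ := hn
  have hn' : (0 : ℝ) < n := by exact_mod_cast (by omega : 0 < n)
  have hlog := one_le_log_of_three_le hn3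
  have hfrac := abs_le.1 (abs_stubborn_fraction_sub_le hp0 (by linarith) hk)
  have hnρ' : 2 * (1 / (n : ℝ)) ≤ ρ := by
    rw [div_le_iff₀ hρ] at hnρ
    rw [mul_one_div, div_le_iff₀ hn']; linarith
  have hnp' : 2 * (1 / (n : ℝ)) ≤ p := by
    rw [div_le_iff₀ hp0] at hnp
    rw [mul_one_div, div_le_iff₀ hn']; linarith
  have hg : ρ ≤ growthRate n k := by rw [growthRate]; linarith [hfrac.2]
  have hvk : v ≤ k / (n + 3 * k) / 2 := by linarith [hfrac.1]
  -- Then (1 - a)^T₀ ≤ n⁻³, which beats the prefactor 2n of the potential.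
  obtain ⟨T₀, hT₀⟩ : ∃ T₀, T₀ = ⌈3 / a * Real.log n⌉₊ := ⟨_, rfl⟩
  have hTC : ((T₀ + 1 : ℕ) : ℝ) ≤ C * Real.log n := by
    rw [hCdef, hT₀]; exact ceil_add_le_mul_log (by positivity) 1 hlog
  refine le_trans (sub_le_sub_left ?_ 1) (one_sub_le_measureReal
    (B := {ω | ∃ t < T₀ + 1 + n, ¬ FollowsMean (ρ ^ 2 / 30) (stubbornProcess x ω t)
        fun u => ω (t, u)} ∪
      {ω | ∀ t ≤ T₀, stubbornProcess x ω (t + 1) ∈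
        {y : Config n | |relBias k y| < ρ ∧ -(ρ / 2) ≤ relExcess k y}}) ?_
    ((measureReal_union_le _ _).trans (add_le_add
      (measure_exists_not_followsMean_le (by positivity) _ x)
      (measure_forall_small_bias_le hv hv1 hρ (by linarith) hη hη1 hη2 hvk hg T₀ x))))
  · refine failure_le (C := C + 1) (K := 4 * (6 / b ^ 3)) hn' ?_ (by positivity) ?_ (by positivity)
      ?_ hnK
    · have := Real.log_le_self hn'.le
      push_cast at hTC ⊢
      nlinarith
    · have h := exp_neg_le (b * n) (by positivity)
      have he : (ρ ^ 2 / 30) ^ 2 * n / 2 = b * n := by rw [hbdef]; ring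
      rw [he]
      calc 4 * Real.exp (-(b * n)) ≤ 4 * (6 / (b * n) ^ 3) := by gcongr
        _ = _ := by field_simp
    · rw [← hadef, hT₀]
      have h := one_sub_pow_ceil_le (c := 3) ha ha1 (n := n) (by omega)
      have h3 : (n : ℝ) ^ (-(3 : ℝ)) = 1 / (n : ℝ) ^ 3 := by
        rw [Real.rpow_neg hn'.le, one_div]
        norm_cast
      rw [h3] at h
      calc (1 - a) ^ ⌈3 / a * Real.log n⌉₊ * (2 * (n : ℝ)) ≤ 1 / (n : ℝ) ^ 3 * (2 * n) := by gcongr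
        _ = _ := by ring
  · intro ω hω
    simp only [Set.mem_union, Set.mem_ofPred_eq, not_or, not_exists, not_and, not_not] at hω
    obtain ⟨hfollow, hexit⟩ := hω
    have hs := fun t ht => (hfollow t ht).1
    have hd := fun t ht => (hfollow t ht).2
    obtain ⟨T, hT, hTρ⟩ := exists_abs_relBias_ge (k := k) (x := stubbornProcess x ω) (T := T₀)
      (L := T₀ + 1 + n) hρ hρ1 (by omega) hd hexit
    have hTC' : (T : ℝ) ≤ C * Real.log n := le_trans (by exact_mod_cast hT) hTC
    rw [Set.mem_ofPred_eq]
    rcases le_abs.1 hTρ with h | h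
    · left
      refine entersPhase_of_forall hTC' (Nat.add_le_add_right hT n) fun t ht htL => ?_
      have hb := bias_persists (k := k) (e := 1) (x := stubbornProcess x ω) (Or.inl rfl)
        hρ hρ1 hg hs hd (by rwa [one_mul]) t ht htL
      rwa [one_mul (bias _ : ℝ)] at hb
    · right
      refine entersPhase_of_forall hTC' (Nat.add_le_add_right hT n) fun t ht htL => ?_
      have hb := bias_persists (k := k) (e := -1) (x := stubbornProcess x ω) (Or.inr rfl)
        hρ hρ1 hg hs hd (by rwa [neg_one_mul]) t ht htL
      rwa [neg_one_mul] at hb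

theorem exists_phase_small_bias {p : ℝ} (hp0 : 1 / 6 < p) (hp : p < 1 / 3) :
    ∃ C > (0 : ℝ), ∃ c > (0 : ℝ), ∃ lam > (0 : ℝ), ∃ M > (0 : ℝ),
      ∃ γ > (0 : ℝ), ∃ n₀ : ℕ, ∀ (n : ℕ) [NeZero n], n₀ ≤ n →
        ∀ k : ℕ, |(k : ℝ) - p / (1 - 3 * p) * n| < 1 → ∀ x : Config n,
          1 - (n : ℝ) ^ (-γ) ≤ (choiceMeasure n k).real
            {ω | EntersPhase (stubbornProcess x ω) (C * Real.log n) (c * (n : ℝ) ^ lam)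
                  (fun s => |(s : ℝ)| ≤ M * Real.sqrt (n * Real.log n))} := by
  obtain ⟨r, hrdef⟩ : ∃ r, r = (p - 1 / 6) / 2 := ⟨_, rfl⟩
  have hr : 0 < r := by linarith
  have hr1 : r < 1 := by linarith
  obtain ⟨j, hj⟩ := exists_pow_lt_of_lt_one hr (by norm_num : (1 / 2 : ℝ) < 1)
  -- One round bounds d from below, j rounds bring it under r, and about (log n)/r rounds contract
  -- the bias.
  obtain ⟨C, hCdef⟩ : ∃ C : ℝ, C = 1 / r + 1 + (1 + j : ℕ) := ⟨_, rfl⟩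
  have hC : 0 < C := by rw [hCdef]; positivity
  have h3p : 0 < 1 - 3 * p := by linarith
  have hpp : 0 < p / (1 - 3 * p) := div_pos (by linarith) h3p
  -- The factor 1 + 1/r is the accumulated error, 4 comes from δ, and the last factor bounds N/n.
  obtain ⟨M, hMdef⟩ : ∃ M : ℝ, M = (1 + 1 / r) * 4 * (1 + 3 * (p / (1 - 3 * p) + 1)) := ⟨_, rfl⟩
  have hM : 0 < M := by rw [hMdef]; positivity
  have htend : Filter.Tendsto (fun n : ℕ => Real.log n / n) Filter.atTop (nhds 0) := by
    have h := (Real.tendsto_pow_log_div_mul_add_atTop 1 0 1 one_ne_zero).comp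
      tendsto_natCast_atTop_atTop
    simpa [Function.comp_def] using h
  have hev : ∀ᶠ n : ℕ in Filter.atTop, Real.log n / n < (r / 36 / 4) ^ 2 :=
    htend.eventually_lt_const (by positivity)
  obtain ⟨n₁, hn₁⟩ := Filter.eventually_atTop.1 hev
  refine ⟨C, hC, 1, one_pos, 1, one_pos, M, hM, 1, one_pos,
    max 3 (max n₁ (max ⌈1 / r⌉₊ ⌈(C + 1) * 4 + 2⌉₊)), ?_⟩
  intro n _ hn k hk x
  simp only [max_le_iff, Nat.ceil_le] at hn
  obtain ⟨hn3, hn1, hnr, hnK⟩ := hn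
  have hn3' : (3 : ℝ) ≤ n := by exact_mod_cast hn3
  have hn' : (0 : ℝ) < n := by linarith
  have hk0 : (0 : ℝ) ≤ k := Nat.cast_nonneg k
  have hN : (0 : ℝ) < n + 3 * k := by positivity
  have hlog := one_le_log_of_three_le hn3
  have hfrac := abs_le.1 (abs_stubborn_fraction_sub_le (by linarith) hp hk)
  have hnr' : 1 / (n : ℝ) ≤ r := by
    rw [div_le_iff₀ hr] at hnr
    rw [div_le_iff₀ hn']; linarith
  have hph : 1 / 6 + r ≤ (k : ℝ) / (n + 3 * k) := by linarith [hfrac.1]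
  have hph3 : (k : ℝ) / (n + 3 * k) < 1 / 3 := by
    rw [div_lt_iff₀ hN]; linarith
  have hg : growthRate n k ≤ -(2 * r) := by rw [growthRate]; linarith
  -- This makes δ²n/2 = 8 log n, so a round fails with probability at most 4n⁻⁸; only 4n⁻³ is needed
  -- for the union bound.
  obtain ⟨δ, hδdef⟩ : ∃ δ, δ = 4 * Real.sqrt (Real.log n / n) := ⟨_, rfl⟩
  have hδ0 : 0 ≤ δ := by rw [hδdef]; positivity
  have hδ2 : δ ^ 2 = 16 * (Real.log n / n) := by
    rw [hδdef, mul_pow, Real.sq_sqrt (by positivity)]; norm_num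
  have hδr : 36 * δ ≤ r := by
    have := Real.sqrt_lt_sqrt (by positivity) (hn₁ n hn1)
    rw [Real.sqrt_sq (by positivity)] at this
    linarith
  have hδn : 1 / (n : ℝ) ≤ δ := by
    refine le_of_sq_le_sq ?_ hδ0
    rw [hδ2, div_pow, one_pow, sq, ← div_div]
    have h1 : 1 / (n : ℝ) ≤ 1 := by rw [div_le_one hn']; linarith
    have h2 : 1 / (n : ℝ) / n ≤ 1 / n := by gcongr
    have h3 : 1 / (n : ℝ) ≤ Real.log n / n := by gcongr
    have h4 : 0 < 1 / (n : ℝ) := by positivity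
    linarith
  obtain ⟨I, hI⟩ : ∃ I, I = ⌈1 / r * Real.log n⌉₊ := ⟨_, rfl⟩
  have hTC : ((I + (1 + j) : ℕ) : ℝ) ≤ C * Real.log n := by
    rw [hCdef, hI]; exact ceil_add_le_mul_log (by positivity) (1 + j) hlog
  refine le_trans (sub_le_sub_left ?_ 1) (one_sub_le_measureReal
    (B := {ω | ∃ t < I + (1 + j) + n, ¬ FollowsMean δ (stubbornProcess x ω t)
        fun u => ω (t, u)}) ?_ (measure_exists_not_followsMean_le hδ0 _ x))
  · rw [← add_zero (((I + (1 + j) + n : ℕ) : ℝ) * _)]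
    refine failure_le (C := C + 1) (K := 4) hn' ?_ (by positivity) ?_ (by positivity)
      (by positivity) hnK
    · have := Real.log_le_self hn'.le
      push_cast at hTC ⊢
      nlinarith
    · have he : δ ^ 2 * n / 2 = 8 * Real.log n := by
        rw [hδ2]; field_simp; norm_num
      have h3 : Real.exp (-(3 * Real.log n)) = 1 / (n : ℝ) ^ 3 := by
        rw [Real.exp_neg, one_div, mul_comm, ← Real.rpow_def_of_pos hn']
        norm_cast
      rw [he]
      calc 4 * Real.exp (-(8 * Real.log n)) ≤ 4 * Real.exp (-(3 * Real.log n)) := by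
            gcongr; norm_num
        _ = _ := by rw [h3]; ring
  · intro ω hω
    simp only [Set.mem_ofPred_eq, not_exists, not_and, not_not] at hω
    rw [Set.mem_ofPred_eq]
    refine entersPhase_of_forall hTC le_rfl fun t ht htL => ?_
    have hm := ordinary_fraction n k
    have hsmall := bias_small_of_followsMean (r := r) (g := growthRate n k) (δ := δ)
      (s := fun t => relBias k (stubbornProcess x ω t))
      (d := fun t => relExcess k (stubbornProcess x ω t)) (j := j) (I := I) (L := I + (1 + j) + n)
      hr hr1 hg (fun t => by
        have := one_sub_stubborn_fraction_le (k := k) (stubbornProcess x ω t)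
        linarith) (fun t => by
        have h1 := abs_relBias_le (k := k) (stubbornProcess x ω t)
        have h2 := neg_le_relExcess (k := k) (stubbornProcess x ω t)
        rw [hm] at h1 h2
        linarith) (fun t => by
        have h1 := abs_relBias_le (k := k) (stubbornProcess x ω t)
        rw [hm] at h1
        linarith [abs_nonneg (relBias k (stubbornProcess x ω t))]) hδ0 (by linarith) hδr hj.le
      (by
        have h := one_sub_pow_ceil_le (c := 1) hr hr1.le (n := n) (by omega)
        rw [Real.rpow_neg_one, ← one_div, ← hI] at h
        exact h.trans hδn)
      (fun t ht => (hω t ht).1) (fun t ht => (hω t ht).2) t (by omega) htL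
    have hNn : (n : ℝ) + 3 * k ≤ (1 + 3 * (p / (1 - 3 * p) + 1)) * n := by
      have := (abs_lt.1 hk).2
      linarith
    have hsq : Real.sqrt (Real.log n / n) * n = Real.sqrt (n * Real.log n) := by
      have h1 : (n : ℝ) * Real.log n = Real.log n / n * (n : ℝ) ^ 2 := by field_simp
      rw [h1, Real.sqrt_mul (by positivity), Real.sqrt_sq hn'.le]
    rw [bias_eq_relBias_mul k, abs_mul, abs_of_pos hN]
    calc |relBias k (stubbornProcess x ω t)| * (n + 3 * k)
        ≤ (1 + 1 / r) * δ * ((1 + 3 * (p / (1 - 3 * p) + 1)) * n) := by gcongr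
      _ = M * (Real.sqrt (Real.log n / n) * n) := by rw [hδdef, hMdef]; ring
      _ = _ := by rw [hsq]

theorem mainTheorem7 (p : ℝ) (hp0 : 0 < p) (hp : p < 1 / 3) :
    (p < 1 / 6 →
      ∃ C > (0 : ℝ), ∃ c > (0 : ℝ), ∃ lam > (0 : ℝ), ∃ c₁ > (0 : ℝ), ∃ c₂ > (0 : ℝ),
        ∃ γ > (0 : ℝ), ∃ n₀ : ℕ, ∀ (n : ℕ) [NeZero n], n₀ ≤ n →
          ∀ k : ℕ, |(k : ℝ) - p / (1 - 3 * p) * n| < 1 → ∀ x : Config n,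
            1 - (n : ℝ) ^ (-γ) ≤ (choiceMeasure n k).real
              {ω | EntersPhase (stubbornProcess x ω) (C * Real.log n) (c * (n : ℝ) ^ lam)
                    (fun s => c₁ * n ≤ (s : ℝ) ∧ (s : ℝ) ≤ c₂ * n) ∨
                  EntersPhase (stubbornProcess x ω) (C * Real.log n) (c * (n : ℝ) ^ lam)
                    (fun s => c₁ * n ≤ -(s : ℝ) ∧ -(s : ℝ) ≤ c₂ * n)}) ∧
    (1 / 6 < p →
      ∃ C > (0 : ℝ), ∃ c > (0 : ℝ), ∃ lam > (0 : ℝ), ∃ M > (0 : ℝ),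
        ∃ γ > (0 : ℝ), ∃ n₀ : ℕ, ∀ (n : ℕ) [NeZero n], n₀ ≤ n →
          ∀ k : ℕ, |(k : ℝ) - p / (1 - 3 * p) * n| < 1 → ∀ x : Config n,
            1 - (n : ℝ) ^ (-γ) ≤ (choiceMeasure n k).real
              {ω | EntersPhase (stubbornProcess x ω) (C * Real.log n) (c * (n : ℝ) ^ lam)
                    (fun s => |(s : ℝ)| ≤ M * Real.sqrt (n * Real.log n))}) := by
  exact ⟨exists_phase_large_bias hp0, fun h => exists_phase_small_bias h hp⟩
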